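/- Let $N=m+n$ and consider a system $\ddot y^{\mu}=\omega^{\mu}(x,y,\dot y)$, $\mu=1,\dots,N$, with $\omega$ smooth on an open set $U$ of jets $(x,y,\dot y)$; let $D$ be the set of the points $(x,y)$ underlying $U$, and let $\mathbf A=\partial_x+\dot y^{\kappa}\partial_{y^{\kappa}}+\omega^{\kappa}\partial_{\dot y^{\kappa}}$. Let $\mathbf Z_M=\xi_M(x,y)\partial_x+\eta^{\mu}_M(x,y)\partial_{y^{\mu}}$, $M=1,\dots,r$, be smooth vector fields on $D$, linearly independent over $\mathbb R$ on every nonempty open subset of $D$, with first prolongations $\mathbf Z^{(1)}_M=\xi_M\partial_x+\eta_M^\mu\partial_{y^\mu}+\bigl(\tfrac{d\eta_M^\mu}{dx}-\dot y^\mu\tfrac{d\xi_M}{dx}\bigr)\partial_{\dot y^\mu}$. Assume that they are Lie point symmetries, $[\mathbf Z^{(1)}_M,\mathbf A]=-\mathbf A(\xi_M)\mathbf A$ on $U$, and form a Lie algebra, $[\mathbf Z_M,\mathbf Z_N]=C^{L}_{MN}\mathbf Z_L$ with constant $C^L_{MN}$. Let $m\le r$ and suppose that $\mathbf Z_i$,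 $i=1,\dots,m$, commute and act transitively in a subspace of dimension $m$, i.e. are linearly independent at every point of $D$. If $n=0$, suppose moreover that $\mathbf A$ is linearly independent of the generators: on no nonempty open subset of $U$ is $\mathbf A$ at every point a combination of the $\mathbf Z_M^{(1)}$ (with coefficients depending on the point). Then around every point of $D$ there are smooth coordinates $(t,s^i,s^\alpha)$, $i=1,\dots,m$, $\alpha=m+1,\dots,N$, in which $\mathbf Z_i=\partial_{s^i}$ for all $i$. Take any such coordinates (on a nonempty open subset of $D$) with $t$ as independent and $s^i,s^\alpha$ as dependent variables. In them the system reads $\ddot s^\mu=\tilde\omega^\mu(t,s,\dot s)$ on the set $\tilde U$ of those jets $(t,s,\dot s)$ that come from $U$; let $\mathbf A$ now denote its operator $\partial_t+\dot s^\mu\partial_{s^\mu}+\tilde\omega^\mu\partial_{\dot s^\mu}$, and $\mathbf Z_M=\xi_M\partial_t+\eta_M^\mu\partial_{s^\mu}$, $\mathbf Z_M^{(1)}$ the generators and their prolongations in the new variables. Let $\hat{\mathbf A}$ and $\mathbf Y_M$ be $\mathbf A$ and $\mathbf Z^{(1)}_M$ without their components along $\partial_{s^1},\dots,\partial_{s^m}$.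 For $M>m$ the generator $\mathbf Z_M$ is called inherited if $[\mathbf Y_M,\hat{\mathbf A}]=-\hat{\mathbf A}(\xi_M)\hat{\mathbf A}$ on $\tilde U$, and likewise for any element of the Lie algebra; inherited generators carry indices $\bar l,\bar k,\bar q>m$. 1. For $M>m$, $\mathbf Z_M$ is inherited if and only if $[\mathbf Z_i,\mathbf Z_M]=\sum_{l\le m}C^{l}_{iM}\mathbf Z_l$ for all $i=1,\dots,m$. Furthermore, on every open $V\subseteq\tilde U$ such that the slices of $V$, and of its projection to the variables $(t,s)$, obtained by fixing all variables but $s^1,\dots,s^m$ are connected (for instance a ball), the reduced objects in the variables $(t,s^\alpha,u^i=\dot s^i,\dot s^\alpha)$ do not depend on the $s^i$: there are smooth functions of the indicated variables with 2. $\hat{\mathbf A}=\partial_t+\dot s^\beta\partial_{s^\beta}+\hat\omega^i(t,s^\alpha,u^j,\dot s^\alpha)\partial_{u^i}+\hat\omega^\beta(t,s^\alpha,u^j,\dot s^\alpha)\partial_{\dot s^\beta}$; 3. $\mathbf Y_{\bar l}=\xi_{\bar l}(t,s^\alpha)\partial_t+\eta^\beta_{\bar l}(t,s^\alpha)\partial_{s^\beta}+\eta^{(1)i}_{\bar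 l}(t,s^\alpha,u^j,\dot s^\alpha)\partial_{u^i}+\eta^{(1)\beta}_{\bar l}(t,s^\alpha,u^j,\dot s^\alpha)\partial_{\dot s^\beta}$ for every inherited $\mathbf Z_{\bar l}$, and in the reduced variables $[\mathbf Y_{\bar l},\hat{\mathbf A}]=-\hat{\mathbf A}(\xi_{\bar l})\hat{\mathbf A}$; 4. for inherited $\mathbf Z_{\bar l},\mathbf Z_{\bar k}$ one has $[\mathbf Y_{\bar l},\mathbf Y_{\bar k}]=\sum_{q>m}C^{q}_{\bar l\bar k}\mathbf Y_q$. If every inherited element of the Lie algebra spanned by the $\mathbf Z_M$ is a linear combination of the $\mathbf Z_i$ and the inherited $\mathbf Z_{\bar q}$, then $C^{\tau}_{\bar l\bar k}=0$ for every $\tau>m$ with $\mathbf Z_\tau$ not inherited, and $[\mathbf Y_{\bar l},\mathbf Y_{\bar k}]=\sum_{\bar q}C^{\bar q}_{\bar l\bar k}\mathbf Y_{\bar q}$. -/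

import Mathlib

open Set
open scoped ContDiff

noncomputable section

namespace ODESymmetry

/-! ### Points, jets, prolongations -/

/-- Space of the independent variable `x` and the dependent variables `y^μ`, `μ ∈ ι`. -/
abbrev Base (ι : Type) : Type := ℝ × (ι → ℝ)

/-- Space of first order jets `(x, y^μ, ẏ^μ)`. -/
abbrev Jet (ι : Type) : Type := ℝ × (ι → ℝ) × (ι → ℝ)

/-- `(x, y, ẏ) ↦ (x, y)`. -/
def toBase {ι : Type} (q : Jet ι) : Base ι := (q.1, q.2.1)

/-- Total derivative `df/dx = ∂f/∂x + ẏ^μ ∂f/∂y^μ` of a function of `(x, y)`. -/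
def totalDeriv {ι : Type} [Fintype ι] {F : Type} [NormedAddCommGroup F] [NormedSpace ℝ F]
    (f : Base ι → F) (q : Jet ι) : F :=
  fderiv ℝ f (toBase q) (1, q.2.2)

/-- The operator `A = ∂_x + ẏ^μ ∂_{y^μ} + w^μ(x, y, ẏ) ∂_{ẏ^μ}` of the system `ÿ = w(x, y, ẏ)`,
as a vector field on the jet space. -/
def odeOperator {ι : Type} (w : Jet ι → ι → ℝ) (q : Jet ι) : Jet ι := (1, q.2.2, w q)

/-- First prolongation of `Z = ξ ∂_x + η^μ ∂_{y^μ}`: the `∂_{ẏ^μ}` component is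
`dη^μ/dx - ẏ^μ dξ/dx`. -/
def prolong {ι : Type} [Fintype ι] (Z : Base ι → Base ι) (q : Jet ι) : Jet ι :=
  ((Z (toBase q)).1, (Z (toBase q)).2, (totalDeriv Z q).2 - (totalDeriv Z q).1 • q.2.2)

/-- `Z = ξ ∂_x + η^μ ∂_{y^μ}` is (the generator of) a Lie point symmetry of `ÿ = w(x, y, ẏ)`
on `U`: `[Z⁽¹⁾, A] = -A(ξ) A`. -/
def IsPointSymmetry {ι : Type} [Fintype ι] (w : Jet ι → ι → ℝ) (U : Set (Jet ι))
    (Z : Base ι → Base ι) : Prop :=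
  ∀ q ∈ U, VectorField.lieBracket ℝ (prolong Z) (odeOperator w) q =
    -(fderiv ℝ (fun q : Jet ι => (Z (toBase q)).1) q (odeOperator w q)) • odeOperator w q

/-! ### Change of the independent and the dependent variables -/

/-- Action of a map `(x, y) ↦ (t, s)` on first order jets: `ṡ = (ds/dx) / (dt/dx)`
(meaningful where `dt/dx ≠ 0`). -/
def jetLift {ι κ : Type} [Fintype ι] [Fintype κ] (f : Base ι → Base κ) (q : Jet ι) : Jet κ :=
  ((f (toBase q)).1, (f (toBase q)).2, (totalDeriv f q).1⁻¹ • (totalDeriv f q).2)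

/-- A vector field on the space of variables, expressed in the new variables. -/
def transformField {ι κ : Type} [Fintype ι] [Fintype κ]
    (Φ : OpenPartialHomeomorph (Base ι) (Base κ)) (Z : Base ι → Base ι) (p : Base κ) : Base κ :=
  fderiv ℝ Φ (Φ.symm p) (Z (Φ.symm p))

/-- The set of jets in the new variables which come from jets in `U`. -/
def transformDomain {ι κ : Type} [Fintype ι] [Fintype κ]
    (Φ : OpenPartialHomeomorph (Base ι) (Base κ)) (U : Set (Jet ι)) : Set (Jet κ) :=
  {q | toBase q ∈ Φ.target ∧ (totalDeriv Φ.symm q).1 ≠ 0 ∧ jetLift Φ.symm q ∈ U}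

/-- Right-hand side of the system `ÿ = w(x, y, ẏ)` written in the new variables `(t, s)`:
`s̈ = A(ṡ) / A(t)`, as a function of the new jet `q = (t, s, ṡ)`. -/
def transformRHS {ι κ : Type} [Fintype ι] [Fintype κ]
    (Φ : OpenPartialHomeomorph (Base ι) (Base κ)) (w : Jet ι → ι → ℝ) (q : Jet κ) : κ → ℝ :=
  (totalDeriv Φ (jetLift Φ.symm q)).1⁻¹ •
    (fderiv ℝ (jetLift Φ) (jetLift Φ.symm q) (odeOperator w (jetLift Φ.symm q))).2.2

/-- `Φ : (x, y) ↦ (t, s^i, s^α)` is a smooth invertible change of variables on a nonempty open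
subset of `D` which puts the vector fields `Z i` in the normal form `Z i = ∂_{s^i}`.
The index `Sum.inl i` stands for `s^i` and `Sum.inr α` for `s^α`. -/
structure IsNormalForm {ι : Type} [Fintype ι] {m n : ℕ} (D : Set (Base ι))
    (Z : Fin m → Base ι → Base ι)
    (Φ : OpenPartialHomeomorph (Base ι) (Base (Fin m ⊕ Fin n))) : Prop where
  source_nonempty : Φ.source.Nonempty
  source_subset : Φ.source ⊆ D
  contDiffOn : ContDiffOn ℝ ∞ Φ Φ.source
  contDiffOn_symm : ContDiffOn ℝ ∞ Φ.symm Φ.target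
  normal_form : ∀ i, ∀ p ∈ Φ.target, transformField Φ (Z i) p = (0, Pi.single (Sum.inl i) 1)

/-! ### Reduction to the hypersurfaces `s^i = const`, `u^i = ṡ^i` -/

/-- The part of a vector field on the jets `(t, s^i, s^α, ṡ^i, ṡ^α)` without the components
along `∂_{s^i}`. -/
def dropS {m n : ℕ} (X : Jet (Fin m ⊕ Fin n) → Jet (Fin m ⊕ Fin n)) (q : Jet (Fin m ⊕ Fin n)) :
    Jet (Fin m ⊕ Fin n) :=
  ((X q).1, Sum.elim 0 (fun β => (X q).2.1 (Sum.inr β)), (X q).2.2)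

/-- `Z` is inherited by the reduced system: with `Y` and `Â` the vector fields `Z⁽¹⁾` and `A`,
written in the variables `(t, s^i, s^α)` and deprived of their components along `∂_{s^i}`,
one has `[Y, Â] = -Â(ξ) Â`. -/
def IsInherited {ι : Type} [Fintype ι] {m n : ℕ}
    (Φ : OpenPartialHomeomorph (Base ι) (Base (Fin m ⊕ Fin n)))
    (w : Jet ι → ι → ℝ) (U : Set (Jet ι)) (Z : Base ι → Base ι) : Prop :=
  ∀ q ∈ transformDomain Φ U,
    VectorField.lieBracket ℝ (dropS (prolong (transformField Φ Z)))
        (dropS (odeOperator (transformRHS Φ w))) q =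
      -(fderiv ℝ (fun q : Jet (Fin m ⊕ Fin n) => (transformField Φ Z (toBase q)).1) q
          (dropS (odeOperator (transformRHS Φ w)) q)) •
        dropS (odeOperator (transformRHS Φ w)) q

/-- The (finite) set of the indices `l` for which `Z l` is inherited. -/
def inheritedIndices {ι : Type} [Fintype ι] {m n k : ℕ}
    (Φ : OpenPartialHomeomorph (Base ι) (Base (Fin m ⊕ Fin n)))
    (w : Jet ι → ι → ℝ) (U : Set (Jet ι)) (Z : Fin k → Base ι → Base ι) : Finset (Fin k) :=
  open Classical in Finset.univ.filter (fun l => IsInherited Φ w U (Z l))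

/-- Space of the reduced variables `(t, s^α, u^i, ṡ^α)`. -/
abbrev Reduced (m n : ℕ) : Type := ℝ × (Fin n → ℝ) × (Fin m → ℝ) × (Fin n → ℝ)

/-- `(t, s^i, s^α, ṡ^i, ṡ^α) ↦ (t, s^α, u^i = ṡ^i, ṡ^α)`. This map is linear, so it also gives
the components along `∂_t`, `∂_{s^α}`, `∂_{u^i}`, `∂_{ṡ^α}` of a tangent vector. -/
def toReduced {m n : ℕ} (q : Jet (Fin m ⊕ Fin n)) : Reduced m n :=
  (q.1, fun β => q.2.1 (Sum.inr β), fun i => q.2.2 (Sum.inl i), fun β => q.2.2 (Sum.inr β))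

/-- `(t, s^i, s^α) ↦ (t, s^α)`. -/
def toReducedBase {m n : ℕ} (p : Base (Fin m ⊕ Fin n)) : Base (Fin n) :=
  (p.1, fun β => p.2 (Sum.inr β))

/-- The subsets obtained from `V`, and from its projection to the variables `(t, s^i, s^α)`, by
fixing the values of all variables but the `s^i` are connected. -/
def ConnectedSlices {m n : ℕ} (V : Set (Jet (Fin m ⊕ Fin n))) : Prop :=
  (∀ r, IsPreconnected (V ∩ toReduced ⁻¹' {r})) ∧
    ∀ b, IsPreconnected (toBase '' V ∩ toReducedBase ⁻¹' {b})

/-- `∂_t + ṡ^β ∂_{s^β} + w^i(t, s^α, u^j, ṡ^α) ∂_{u^i} + w^β(t, s^α, u^j, ṡ^α) ∂_{ṡ^β}`. -/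
def reducedOperator {m n : ℕ} (w : Reduced m n → Fin m ⊕ Fin n → ℝ) (r : Reduced m n) :
    Reduced m n :=
  (1, r.2.2.2, fun i => w r (Sum.inl i), fun β => w r (Sum.inr β))

/-- `ξ(t, s^α) ∂_t + η^β(t, s^α) ∂_{s^β} + ζ^i(t, s^α, u^j, ṡ^α) ∂_{u^i} +
ζ^β(t, s^α, u^j, ṡ^α) ∂_{ṡ^β}`. -/
def reducedField {m n : ℕ} (ξ : Base (Fin n) → ℝ) (η : Base (Fin n) → Fin n → ℝ)
    (ζ : Reduced m n → Fin m ⊕ Fin n → ℝ) (r : Reduced m n) : Reduced m n :=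
  (ξ (r.1, r.2.1), η (r.1, r.2.1), fun i => ζ r (Sum.inl i), fun β => ζ r (Sum.inr β))

end ODESymmetry

end

open ODESymmetry

/-! Commuting independent fields are straightened by their joint flow: flowing out of a slice
transversal to the $Z_i$ gives coordinates with $Z_i=\partial_{s^i}$ (`exists_isNormalForm`). The
flow and its smooth dependence on times and initial point come from the inverse function theorem in
$C([0,1],E)$, applied to the integral equation of the trajectories; commutation identifies the
derivative in the $i$-th time with $Z_i$ (`exists_joint_flow`).

Brackets, prolongations and symmetries are compatible with changes of variables, so everything can
be studied in straightened coordinates (`isStraightened_of_isNormalForm`). There the symmetry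
$\partial_{s^i}$ says that the right-hand side does not depend on $s^i$. Put
$W_j=\partial_{s^j}Z_M=[Z_j,Z_M]$. By `isReducedSymmetry_iff`, $Z_M$ is inherited iff $\sum_j\dot
s^j\,(W_j^{(1)}-W_j^t\mathbf A)$ vanishes modulo the $\partial_{s^i}$. At a fixed base point this
holds for an open set of velocities. Its $\partial_{s^\beta}$ components are polynomials in $\dot s$
whose vanishing gives $W_j^\beta=0$ and $W_j^t=0$; for $n=0$ there are no such components, and the
independence of $\mathbf A$ from the generators gives $W_j^t=0$ instead. The velocity components are
then polynomials too, and with $\partial_kW_j=\partial_jW_k$ they force $dW_j=0$. So $W_j$ is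
locally a constant combination of the $\partial_{s^i}$, which by linear independence over $\mathbb
R$ is a condition on the structure constants. Conversely, such a $W_j$ has its prolongation along
the $\partial_{s^i}$, and this part is dropped.

Hence the components of $\mathbf A$ and of the inherited fields that survive the dropping are
constant along the $s^i$ and descend to the reduced variables wherever slices are connected
(`ContDiffOn.exists_factor`). The projection is linear and relates the fields, so brackets descend
as well (`IsStraightened.exists_reduction`). By the Jacobi identity the bracket of two inherited
generators is inherited, which removes the non-inherited terms in the last claim. -/

open Filter Topology VectorField

/-! ### Related vector fields, inverse functions, factorization through projections, polynomials. -/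

section Calculus

variable {E F : Type*} [NormedAddCommGroup E] [NormedSpace ℝ E]
  [NormedAddCommGroup F] [NormedSpace ℝ F]

theorem lieBracket_apply (V W : E → E) (x : E) :
    lieBracket ℝ V W x = fderiv ℝ W x (V x) - fderiv ℝ V x (W x) := rfl

/-- The Lie brackets of related vector fields are related. -/
theorem lieBracket_of_related {f : E → F} {x : E} (hf : ContDiffAt ℝ 2 f x)
    {V W : E → E} {V' W' : F → F}
    (hV : DifferentiableAt ℝ V x) (hW : DifferentiableAt ℝ W x)
    (hV' : DifferentiableAt ℝ V' (f x)) (hW' : DifferentiableAt ℝ W' (f x))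
    (hVV : ∀ᶠ y in 𝓝 x, V' (f y) = fderiv ℝ f y (V y))
    (hWW : ∀ᶠ y in 𝓝 x, W' (f y) = fderiv ℝ f y (W y)) :
    lieBracket ℝ V' W' (f x) = fderiv ℝ f x (lieBracket ℝ V W x) := by
  have hfx : HasFDerivAt f (fderiv ℝ f x) x := (hf.differentiableAt (by norm_num)).hasFDerivAt
  have hff : HasFDerivAt (fderiv ℝ f) (fderiv ℝ (fderiv ℝ f) x) x :=
    ((hf.fderiv_right (m := 1) (by norm_num)).differentiableAt (by norm_num)).hasFDerivAt
  have hsymm : IsSymmSndFDerivAt ℝ f x := hf.isSymmSndFDerivAt (by simp)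
  -- Differentiate the relation $X'\circ f=df\cdot X$ along $v$. In the bracket the terms
  -- $D^2f(V,W)$ and $D^2f(W,V)$ cancel by symmetry.
  have key : ∀ {X : E → E} {X' : F → F}, DifferentiableAt ℝ X x → DifferentiableAt ℝ X' (f x) →
      (∀ᶠ y in 𝓝 x, X' (f y) = fderiv ℝ f y (X y)) → ∀ v,
      fderiv ℝ X' (f x) (fderiv ℝ f x v) =
        fderiv ℝ (fderiv ℝ f) x v (X x) + fderiv ℝ f x (fderiv ℝ X x v) := by
    intro X X' hX hX' h v
    have h1 := hX'.hasFDerivAt.comp x hfx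
    have h2 := (hff.clm_apply hX.hasFDerivAt).congr_of_eventuallyEq h
    have h3 := DFunLike.congr_fun (h1.unique h2) v
    simpa [add_comm] using h3
  rw [lieBracket_eq, lieBracket_eq]
  simp only [hVV.self_of_nhds, hWW.self_of_nhds, key hV hV' hVV, key hW hW' hWW, map_sub]
  rw [hsymm.eq (V x) (W x)]
  abel

theorem ContinuousLinearMap.lieBracket_of_related (f : E →L[ℝ] F) {x : E}
    {V W : E → E} {V' W' : F → F}
    (hV : DifferentiableAt ℝ V x) (hW : DifferentiableAt ℝ W x)
    (hV' : DifferentiableAt ℝ V' (f x)) (hW' : DifferentiableAt ℝ W' (f x))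
    (hVV : ∀ᶠ y in 𝓝 x, V' (f y) = f (V y))
    (hWW : ∀ᶠ y in 𝓝 x, W' (f y) = f (W y)) :
    lieBracket ℝ V' W' (f x) = f (lieBracket ℝ V W x) := by
  have := _root_.lieBracket_of_related (f := f) f.contDiff.contDiffAt hV hW hV' hW'
    (by simpa using hVV) (by simpa using hWW)
  simpa using this

theorem lieBracket_sum_smul_left {κ : Type*} [Fintype κ] (c : κ → ℝ) {V : κ → E → E} {W : E → E}
    {x : E} (hV : ∀ i, DifferentiableAt ℝ (V i) x) :
    lieBracket ℝ (fun y => ∑ i, c i • V i y) W x = ∑ i, c i • lieBracket ℝ (V i) W x := by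
  have h : HasFDerivAt (fun y => ∑ i, c i • V i y) (∑ i, c i • fderiv ℝ (V i) x) x :=
    HasFDerivAt.fun_sum fun i _ => (hV i).hasFDerivAt.const_smul (c i)
  simp only [lieBracket_eq, h.fderiv, map_sum, map_smul, sum_apply,
    smul_apply, smul_sub, Finset.sum_sub_distrib]

/-- Smooth form of the inverse function theorem. -/
theorem ContDiffOn.exists_openPartialHomeomorph [CompleteSpace E] [CompleteSpace F]
    {f : E → F} {U : Set E} (hU : IsOpen U) (hf : ContDiffOn ℝ ∞ f U) {a : E} (ha : a ∈ U)
    (f' : E ≃L[ℝ] F) (hf' : HasFDerivAt f (f' : E →L[ℝ] F) a) :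
    ∃ e : OpenPartialHomeomorph E F, a ∈ e.source ∧ e.source ⊆ U ∧ (∀ x, e x = f x) ∧
      ContDiffOn ℝ ∞ e.symm e.target ∧
      ∀ x ∈ e.source, ∃ A : E ≃L[ℝ] F, HasFDerivAt f (A : E →L[ℝ] F) x := by
  have hfa : ContDiffAt ℝ ∞ f a := hf.contDiffAt (hU.mem_nhds ha)
  set e₀ := hfa.toOpenPartialHomeomorph f hf' (by simp) with he₀
  have hcoe : ∀ x, e₀ x = f x := fun x => by
    rw [he₀, ContDiffAt.toOpenPartialHomeomorph_coe]
  have hae : a ∈ e₀.source := ContDiffAt.mem_toOpenPartialHomeomorph_source hfa hf' (by simp)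
  -- Smoothness of the inverse at one point does not give it on the whole target, so the source is
  -- cut down to the open set where the derivative is invertible.
  have hO : IsOpen (U ∩ fderiv ℝ f ⁻¹' range ((↑) : (E ≃L[ℝ] F) → E →L[ℝ] F)) :=
    (hf.continuousOn_fderiv_of_isOpen hU (by simp)).isOpen_inter_preimage hU
      ContinuousLinearEquiv.isOpen
  have hinv : ∀ x ∈ U ∩ fderiv ℝ f ⁻¹' range ((↑) : (E ≃L[ℝ] F) → E →L[ℝ] F),
      ∃ A : E ≃L[ℝ] F, HasFDerivAt f (A : E →L[ℝ] F) x := by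
    rintro x ⟨hx, A, hA⟩
    refine ⟨A, ?_⟩
    rw [hA]
    exact ((hf.contDiffAt (hU.mem_nhds hx)).differentiableAt (by simp)).hasFDerivAt
  refine ⟨e₀.restrOpen _ hO, ⟨hae, ha, f', hf'.fderiv.symm⟩, fun x hx => hx.2.1, hcoe, ?_,
    fun x hx => hinv x hx.2⟩
  intro y hy
  have hy' := (e₀.restrOpen _ hO).map_target hy
  obtain ⟨A, hA⟩ := hinv _ hy'.2
  refine ((e₀.restrOpen _ hO).contDiffAt_symm hy (f₀' := A) ?_ ?_).contDiffWithinAt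
  · exact hA.congr_of_eventuallyEq (Eventually.of_forall hcoe)
  · exact (hf.contDiffAt (hU.mem_nhds hy'.2.1)).congr_of_eventuallyEq (Eventually.of_forall hcoe)

/-- A smooth function on an open set whose derivative vanishes along the kernel of a split linear
map with connected fibres factors smoothly through that map. -/
theorem ContDiffOn.exists_factor {R G : Type*} [NormedAddCommGroup R] [NormedSpace ℝ R]
    [NormedAddCommGroup G] [NormedSpace ℝ G] (π : E →L[ℝ] R) (σ : R →L[ℝ] E)
    (hσ : ∀ r, π (σ r) = r) {V : Set E} (hV : IsOpen V)
    (hconn : ∀ r, IsPreconnected (V ∩ π ⁻¹' {r})) {f : E → G} (hf : ContDiffOn ℝ ∞ f V)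
    (hker : ∀ q ∈ V, ∀ v, π v = 0 → fderiv ℝ f q v = 0) :
    ∃ g : R → G, ContDiffOn ℝ ∞ g (π '' V) ∧ ∀ q ∈ V, f q = g (π q) := by
  have hdiff : ∀ q ∈ V, DifferentiableAt ℝ f q := fun q hq =>
    (hf.contDiffAt (hV.mem_nhds hq)).differentiableAt (by simp)
  -- Within a ball, two points of one fibre are joined by a segment in the fibre direction, along
  -- which $f$ has zero derivative.
  have hloc : ∀ q ∈ V, ∀ᶠ q' in 𝓝 q, π q' = π q → f q' = f q := by
    intro q hq
    obtain ⟨ε, hε, hB⟩ := Metric.isOpen_iff.1 hV q hq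
    filter_upwards [Metric.ball_mem_nhds q hε] with q' hq' hπ
    have hseg : ∀ t ∈ Icc (0 : ℝ) 1, q + t • (q' - q) ∈ V := fun t ht => hB <|
      (convex_ball q ε).add_smul_sub_mem (Metric.mem_ball_self hε) hq' ht
    have hd : ∀ t ∈ Icc (0 : ℝ) 1, HasDerivAt (fun t : ℝ => f (q + t • (q' - q))) 0 t := by
      intro t ht
      have h1 : HasDerivAt (fun t : ℝ => q + t • (q' - q)) (q' - q) t := by
        simpa using ((hasDerivAt_id t).smul_const (q' - q)).const_add q
      have h2 := (hdiff _ (hseg t ht)).hasFDerivAt.comp_hasDerivAt t h1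
      rwa [hker _ (hseg t ht) _ (by simp [hπ])] at h2
    have := constant_of_has_deriv_right_zero
      (fun t ht => (hd t ht).continuousAt.continuousWithinAt)
      (fun t ht => (hd t (Ico_subset_Icc_self ht)).hasDerivWithinAt) 1 (by simp)
    simpa using this
  have hconst : ∀ q ∈ V, ∀ q' ∈ V, π q' = π q → f q' = f q := by
    intro q hq q' hq' hπ
    refine (hconn (π q)).induction₂ (fun x y => f y = f x) (fun x hx => ?_)
      (fun _ _ _ _ _ _ h₁ h₂ => h₂.trans h₁) (fun _ _ _ _ h => h.symm) ⟨hq, rfl⟩ ⟨hq', hπ⟩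
    filter_upwards [nhdsWithin_le_nhds (hloc x hx.1), self_mem_nhdsWithin] with y hy hy'
    exact hy (hy'.2.trans hx.2.symm)
  choose! c hc using fun (r : R) (hr : r ∈ π '' V) => hr
  refine ⟨fun r => f (c r), ?_, fun q hq => ?_⟩
  · rintro _ ⟨q, hq, rfl⟩
    -- The chosen points `c r` need not vary continuously. Near `π q` the factor agrees with $f$ on
    -- the affine section through `q`, which is smooth.
    have hcont : Continuous fun r : R => q + σ (r - π q) := by fun_prop
    have hmem : ∀ᶠ r in 𝓝 (π q), q + σ (r - π q) ∈ V :=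
      hcont.continuousAt.eventually_mem (by simpa using hV.mem_nhds hq)
    have hsm : ContDiffAt ℝ ∞ (fun r : R => f (q + σ (r - π q))) (π q) := by
      refine ContDiffAt.comp (g := f) (π q) ?_ (by fun_prop)
      simpa using hf.contDiffAt (hV.mem_nhds hq)
    refine (hsm.congr_of_eventuallyEq ?_).contDiffWithinAt
    filter_upwards [hmem] with r hr
    have hr' : r ∈ π '' V := ⟨_, hr, by simp [hσ]⟩
    exact hconst _ hr _ (hc r hr').1 (by simp [hσ, (hc r hr').2])
  · have hr' : π q ∈ π '' V := ⟨q, hq, rfl⟩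
    exact (hconst q hq _ (hc _ hr').1 (hc _ hr').2).symm

/-- If `L + B(·, ·)` with linear `L` and bilinear `B` vanishes on a nonempty open set, then `L` and
the quadratic form of `B` vanish. -/
theorem linear_add_quadratic_eq_zero (L : E →ₗ[ℝ] F) (B : E →ₗ[ℝ] E →ₗ[ℝ] F)
    {v : E} (h : ∀ᶠ u in 𝓝 v, L u + B u u = 0) : (∀ u, L u = 0) ∧ ∀ u, B u u = 0 := by
  have hB : ∀ u, B u u = 0 := by
    intro u
    have hc : Continuous fun t : ℝ => v + t • u := by fun_prop
    have hc' : Continuous fun t : ℝ => v - t • u := by fun_prop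
    have h1 : ∀ᶠ t : ℝ in 𝓝 0, L (v + t • u) + B (v + t • u) (v + t • u) = 0 :=
      hc.tendsto' 0 v (by simp) |>.eventually h
    have h2 : ∀ᶠ t : ℝ in 𝓝 0, L (v - t • u) + B (v - t • u) (v - t • u) = 0 :=
      hc'.tendsto' 0 v (by simp) |>.eventually h
    obtain ⟨t, ⟨h1, h2⟩, ht⟩ := ((h1.and h2).filter_mono nhdsWithin_le_nhds
      |>.and (self_mem_nhdsWithin (s := {0}ᶜ))).exists
    -- The second difference at $v\pm tu$ removes the linear part and leaves the quadratic one.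
    have h3 : (2 * t ^ 2) • B u u = 0 := by
      have h0 := h.self_of_nhds
      have : (2 * t ^ 2) • B u u = (L (v + t • u) + B (v + t • u) (v + t • u)) +
          (L (v - t • u) + B (v - t • u) (v - t • u)) - (2 : ℝ) • (L v + B v v) := by
        simp only [map_add, map_sub, map_smul, LinearMap.add_apply, LinearMap.sub_apply,
          LinearMap.smul_apply]
        module
      rw [this, h1, h2, h0]; simp
    exact (smul_eq_zero.1 h3).resolve_left (by simpa using ht)
  refine ⟨fun u => ?_, hB⟩
  have hc : Continuous fun t : ℝ => v + t • u := by fun_prop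
  have h1 : ∀ᶠ t : ℝ in 𝓝 0, L (v + t • u) + B (v + t • u) (v + t • u) = 0 :=
    hc.tendsto' 0 v (by simp) |>.eventually h
  obtain ⟨t, h1, ht⟩ := (h1.filter_mono nhdsWithin_le_nhds
      |>.and (self_mem_nhdsWithin (s := {0}ᶜ))).exists
  have h0 := h.self_of_nhds
  rw [hB, add_zero] at h0 h1
  rw [map_add, h0, map_smul, zero_add] at h1
  exact (smul_eq_zero.1 h1).resolve_left ht

end Calculus

/-! ### Smooth operators on spaces of continuous curves. -/

section Superposition

variable {K E F : Type} [TopologicalSpace K] [NormedAddCommGroup E] [NormedAddCommGroup F]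

/-- The superposition operator `γ ↦ f ∘ γ` on continuous maps. -/
def superposition (f : E → F) (hf : Continuous f)
    (γ : C(K, E)) : C(K, F) :=
  (⟨f, hf⟩ : C(E, F)).comp γ

@[simp] theorem superposition_apply (f : E → F)
    (hf : Continuous f) (γ : C(K, E)) (τ : K) : superposition f hf γ τ = f (γ τ) := rfl

theorem continuous_superposition (f : E → F)
    (hf : Continuous f) : Continuous (superposition (K := K) f hf) :=
  ContinuousMap.continuous_postcomp _

variable [CompactSpace K] [NormedSpace ℝ E] [NormedSpace ℝ F]

/-- Pointwise application of a continuous family of continuous linear maps. -/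
noncomputable def pointwiseApply : C(K, E →L[ℝ] F) →L[ℝ] C(K, E) →L[ℝ] C(K, F) :=
  LinearMap.mkContinuous₂
    (LinearMap.mk₂ ℝ (fun (A : C(K, E →L[ℝ] F)) (h : C(K, E)) =>
        (⟨fun τ => A τ (h τ), by fun_prop⟩ : C(K, F)))
      (fun _ _ _ => by ext; simp) (fun _ _ _ => by ext; simp)
      (fun _ _ _ => by ext; simp) (fun _ _ _ => by ext; simp)) 1
    (fun A h => by
      rw [ContinuousMap.norm_le _ (by positivity)]
      intro τ
      rw [one_mul]
      exact (A τ).le_of_opNorm_le_of_le (A.norm_coe_le_norm τ) (h.norm_coe_le_norm τ))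

@[simp] theorem pointwiseApply_apply (A : C(K, E →L[ℝ] F)) (h : C(K, E)) (τ : K) :
    pointwiseApply A h τ = A τ (h τ) := rfl

/-- Composition with `fderiv ℝ f` is continuous for the sup norm, so for small $h$ the derivative of
$f$ along the segments from $\gamma(\tau)$ to $\gamma(\tau)+h(\tau)$ stays within ε of its value at
$\gamma(\tau)$, uniformly in τ. The mean value inequality at each τ then bounds the remainder by
$\varepsilon\|h\|$. -/
theorem hasFDerivAt_superposition {f : E → F} (hf : ContDiff ℝ 1 f) (γ : C(K, E)) :
    HasFDerivAt (superposition f hf.continuous)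
      (pointwiseApply (superposition (fderiv ℝ f) (hf.continuous_fderiv (by simp)) γ)) γ := by
  rw [hasFDerivAt_iff_isLittleO_nhds_zero, Asymptotics.isLittleO_iff]
  intro ε hε
  have hc := (continuous_superposition (K := K) (fderiv ℝ f)
    (hf.continuous_fderiv (by simp))).tendsto γ
  have hball : Metric.closedBall (superposition (K := K) (fderiv ℝ f)
      (hf.continuous_fderiv (by simp)) γ) ε ∈ 𝓝 _ := Metric.closedBall_mem_nhds _ hε
  obtain ⟨δ, hδ, hB⟩ := Metric.eventually_nhds_iff_ball.1 (hc.eventually_mem hball)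
  filter_upwards [Metric.ball_mem_nhds (0 : C(K, E)) hδ] with h hh
  rw [mem_ball_zero_iff] at hh
  rw [ContinuousMap.norm_le _ (by positivity)]
  intro τ
  have key := (convex_segment (γ τ) (γ τ + h τ)).norm_image_sub_le_of_norm_hasFDerivWithin_le'
    (f := f) (f' := fderiv ℝ f) (φ := fderiv ℝ f (γ τ)) (C := ε)
    (fun x _ => ((hf.differentiable (by simp)) x).hasFDerivAt.hasFDerivWithinAt) ?_
    (left_mem_segment ℝ _ _) (right_mem_segment ℝ _ _)
  · simp only [add_sub_cancel_left] at key
    exact key.trans (mul_le_mul_of_nonneg_left (h.norm_coe_le_norm τ) hε.le)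
  · intro x hx
    rw [segment_eq_image'] at hx
    obtain ⟨t, ht, rfl⟩ := hx
    -- A point of the segment is the value at τ of the curve $\gamma+th$, which is itself δ-close to
    -- γ.
    have hmem : γ + t • h ∈ Metric.ball γ δ := by
      rw [mem_ball_iff_norm, add_sub_cancel_left, norm_smul]
      refine lt_of_le_of_lt ?_ hh
      refine mul_le_of_le_one_left (norm_nonneg _) ?_
      rw [Real.norm_eq_abs, abs_le]; constructor <;> linarith [ht.1, ht.2]
    have h1 := hB _ hmem
    rw [mem_closedBall_iff_norm] at h1
    have h2 := (ContinuousMap.norm_coe_le_norm _ τ).trans h1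
    simpa using h2

/-- The derivative is `pointwiseApply` after the superposition operator of `fderiv ℝ f`, so
induction gains one order at a time. The target changes from `F` to `E →L[ℝ] F` at each step, hence
the quantification over `F` inside. -/
theorem contDiff_superposition_nat (n : ℕ) : ∀ {F : Type} [NormedAddCommGroup F] [NormedSpace ℝ F]
    {f : E → F} (hf : ContDiff ℝ n f),
    ContDiff ℝ n (superposition (K := K) f hf.continuous) := by
  induction n with
  | zero =>
    intro F _ _ f hf
    exact contDiff_zero.2 (continuous_superposition _ _)
  | succ n ih =>
    intro F _ _ f hf
    have hf1 : ContDiff ℝ 1 f := hf.of_le (by simp)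
    have hf' : ContDiff ℝ n (fderiv ℝ f) := hf.fderiv_right (by norm_cast)
    have := contDiff_succ_iff_hasFDerivAt.2
      ⟨_, pointwiseApply.contDiff.comp (ih hf'), hasFDerivAt_superposition hf1⟩
    exact_mod_cast this

theorem contDiff_superposition {f : E → F} (hf : ContDiff ℝ ∞ f) :
    ContDiff ℝ ∞ (superposition (K := K) f hf.continuous) :=
  contDiff_infty.2 fun n => contDiff_superposition_nat n (contDiff_infty.1 hf n)

/-- The constant maps, as a continuous linear map. -/
noncomputable def constMapL : E →L[ℝ] C(K, E) :=
  LinearMap.mkContinuous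
    { toFun := fun c => ContinuousMap.const K c
      map_add' := fun _ _ => rfl
      map_smul' := fun _ _ => rfl } 1
    (fun c => by
      rw [ContinuousMap.norm_le _ (by positivity)]
      intro τ
      exact (one_mul ‖c‖).ge)

@[simp] theorem constMapL_apply (c : E) (τ : K) : constMapL c τ = c := rfl

/-- The integration operator `γ ↦ (τ ↦ ∫ σ in 0..τ, γ σ)` on curves over the unit interval. -/
noncomputable def primitiveL [CompleteSpace E] : C(unitInterval, E) →L[ℝ] C(unitInterval, E) :=
  LinearMap.mkContinuous
    { toFun := fun γ => ⟨fun τ => ∫ σ in (0 : ℝ)..τ, γ (projIcc 0 1 zero_le_one σ),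
        (intervalIntegral.continuous_primitive (fun a b =>
          (γ.continuous.comp continuous_projIcc).intervalIntegrable a b) 0).comp
            continuous_subtype_val⟩
      map_add' := fun γ γ' => by
        ext τ
        exact intervalIntegral.integral_add
          ((γ.continuous.comp continuous_projIcc).intervalIntegrable _ _)
          ((γ'.continuous.comp continuous_projIcc).intervalIntegrable _ _)
      map_smul' := fun c γ => by
        ext τ
        exact intervalIntegral.integral_smul c _ } 1
    (fun γ => by
      rw [ContinuousMap.norm_le _ (by positivity)]
      intro τ
      have := intervalIntegral.norm_integral_le_of_norm_le_const (a := 0) (b := τ.1) (C := ‖γ‖)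
        (f := fun σ => γ (projIcc 0 1 zero_le_one σ)) (fun σ _ => γ.norm_coe_le_norm _)
      refine this.trans ?_
      rw [one_mul, sub_zero, abs_of_nonneg τ.2.1]
      exact mul_le_of_le_one_right (norm_nonneg _) τ.2.2)

theorem primitiveL_apply [CompleteSpace E] (γ : C(unitInterval, E)) (τ : unitInterval) :
    primitiveL γ τ = ∫ σ in (0 : ℝ)..τ, γ (projIcc 0 1 zero_le_one σ) := rfl

end Superposition

/-! ### Joint flow of commuting vector fields. -/

section Flow

variable {E : Type} [NormedAddCommGroup E] [NormedSpace ℝ E] {m : ℕ}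

/-- Vector fields smooth near a point agree near that point with globally smooth ones. -/
theorem exists_contDiff_eqOn_ball [FiniteDimensional ℝ E] {D : Set E} (hD : IsOpen D) {p₀ : E}
    (hp₀ : p₀ ∈ D) : ∃ ρ > 0, Metric.ball p₀ ρ ⊆ D ∧ ∀ {Z : E → E}, ContDiffOn ℝ ∞ Z D →
      ∃ g : E → E, ContDiff ℝ ∞ g ∧ EqOn g Z (Metric.ball p₀ ρ) := by
  obtain ⟨ε, hε, hB⟩ := Metric.isOpen_iff.1 hD p₀ hp₀
  -- The bump is 1 on the ball of radius ε/3 and supported in the closed ball of radius ε/2 inside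
  -- `D`. One radius serves all fields, so that several of them can be extended at once.
  let φ : ContDiffBump p₀ := ⟨ε / 3, ε / 2, by positivity, by linarith⟩
  refine ⟨ε / 3, by positivity, (Metric.ball_subset_ball (by linarith)).trans hB, ?_⟩
  intro Z hZ
  refine ⟨fun x => φ x • Z x, ?_, fun x hx => ?_⟩
  · rw [contDiff_iff_contDiffAt]
    intro x
    by_cases hx : x ∈ D
    · exact φ.contDiff.contDiffAt.smul (hZ.contDiffAt (hD.mem_nhds hx))
    · have hx' : x ∉ tsupport φ := by
        rw [φ.tsupport_eq]
        intro h
        exact hx (hB (Metric.closedBall_subset_ball (by change ε / 2 < ε; linarith) h))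
      have : (fun x => φ x • Z x) =ᶠ[𝓝 x] fun _ => 0 := by
        filter_upwards [notMem_tsupport_iff_eventuallyEq.1 hx'] with y hy
        simp [hy]
      exact contDiffAt_const.congr_of_eventuallyEq this
  · have : φ x = 1 := φ.one_of_mem_closedBall (Metric.ball_subset_closedBall hx)
    simp [this]

variable [CompleteSpace E]

/-- `(s, c, γ) ↦ (s, c, γ - c - ∑ s_i ∫ g_i ∘ γ)`: its zeros in the last variable are the
trajectories of `∑ s_i g_i` that start at `c`. -/
noncomputable def trajectoryMap (g : Fin m → E → E) (hg : ∀ i, ContDiff ℝ ∞ (g i))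
    (z : (Fin m → ℝ) × E × C(unitInterval, E)) : (Fin m → ℝ) × E × C(unitInterval, E) :=
  (z.1, z.2.1, z.2.2 - constMapL z.2.1 -
    ∑ i, z.1 i • primitiveL (superposition (g i) (hg i).continuous z.2.2))

theorem contDiff_trajectoryMap (g : Fin m → E → E) (hg : ∀ i, ContDiff ℝ ∞ (g i)) :
    ContDiff ℝ ∞ (trajectoryMap g hg) := by
  have h1 : ∀ i, ContDiff ℝ ∞ fun z : (Fin m → ℝ) × E × C(unitInterval, E) =>
      primitiveL (superposition (g i) (hg i).continuous z.2.2) := fun i =>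
    primitiveL.contDiff.comp ((contDiff_superposition (hg i)).comp contDiff_snd.snd)
  have h2 : ContDiff ℝ ∞ fun z : (Fin m → ℝ) × E × C(unitInterval, E) =>
      (constMapL z.2.1 : C(unitInterval, E)) :=
    (constMapL (K := unitInterval) (E := E)).contDiff.comp contDiff_snd.fst
  have h3 : ∀ i, ContDiff ℝ ∞ fun z : (Fin m → ℝ) × E × C(unitInterval, E) => z.1 i := fun i =>
    (ContinuousLinearMap.proj (R := ℝ) (φ := fun _ : Fin m => ℝ) i).contDiff.comp contDiff_fst
  exact contDiff_fst.prodMk (contDiff_snd.fst.prodMk ((contDiff_snd.snd.sub h2).sub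
    (ContDiff.sum fun i _ => (h3 i).smul (h1 i))))

theorem fderiv_trajectoryMap (g : Fin m → E → E) (hg : ∀ i, ContDiff ℝ ∞ (g i))
    (z v : (Fin m → ℝ) × E × C(unitInterval, E)) :
    fderiv ℝ (trajectoryMap g hg) z v = (v.1, v.2.1, v.2.2 - constMapL v.2.1 -
      ∑ i, (z.1 i • primitiveL (pointwiseApply (superposition (fderiv ℝ (g i))
          ((hg i).continuous_fderiv (by simp)) z.2.2) v.2.2) +
        v.1 i • primitiveL (superposition (g i) (hg i).continuous z.2.2))) := by
  have hγ : HasFDerivAt (fun z : (Fin m → ℝ) × E × C(unitInterval, E) => z.2.2)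
      ((ContinuousLinearMap.snd ℝ _ _).comp (ContinuousLinearMap.snd ℝ _ _)) z :=
    hasFDerivAt_snd.snd
  have hc : HasFDerivAt (fun z : (Fin m → ℝ) × E × C(unitInterval, E) => z.2.1)
      ((ContinuousLinearMap.fst ℝ _ _).comp (ContinuousLinearMap.snd ℝ _ _)) z :=
    hasFDerivAt_snd.fst
  have h1 := fun i => (primitiveL (E := E)).hasFDerivAt.comp z
    ((hasFDerivAt_superposition ((hg i).of_le (by simp)) z.2.2).comp z hγ)
  have h2 := (constMapL (K := unitInterval) (E := E)).hasFDerivAt.comp z hc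
  have h3 : ∀ i, HasFDerivAt (fun z : (Fin m → ℝ) × E × C(unitInterval, E) => z.1 i)
      ((ContinuousLinearMap.proj (R := ℝ) (φ := fun _ : Fin m => ℝ) i).comp
        (ContinuousLinearMap.fst ℝ _ _)) z := fun i =>
    (ContinuousLinearMap.proj (R := ℝ) (φ := fun _ : Fin m => ℝ) i).hasFDerivAt.comp z
      hasFDerivAt_fst
  have := (hasFDerivAt_fst (𝕜 := ℝ) (p := z)).prodMk (hc.prodMk ((hγ.sub h2).sub
    (HasFDerivAt.fun_sum (u := Finset.univ) fun i _ => (h3 i).smul (h1 i))))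
  have h := this.fderiv
  change fderiv ℝ (trajectoryMap g hg) z = _ at h
  rw [h]
  simp

/-- At zero times the terms containing the derivatives of the $g_i$ disappear and the derivative is
unipotent triangular; `G` inverts it by changing the signs of the off-diagonal entries. -/
theorem exists_equiv_hasFDerivAt_trajectoryMap (g : Fin m → E → E)
    (hg : ∀ i, ContDiff ℝ ∞ (g i)) (c : E) (γ : C(unitInterval, E)) :
    ∃ A : ((Fin m → ℝ) × E × C(unitInterval, E)) ≃L[ℝ] ((Fin m → ℝ) × E × C(unitInterval, E)),
      HasFDerivAt (trajectoryMap g hg) (A : _ →L[ℝ] _) (0, c, γ) := by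
  let B : (Fin m → ℝ) →L[ℝ] C(unitInterval, E) :=
    ∑ i, (ContinuousLinearMap.proj (R := ℝ) (φ := fun _ : Fin m => ℝ) i).smulRight
      (primitiveL (superposition (g i) (hg i).continuous γ))
  let G : ((Fin m → ℝ) × E × C(unitInterval, E)) →L[ℝ]
      ((Fin m → ℝ) × E × C(unitInterval, E)) :=
    (ContinuousLinearMap.fst ℝ _ _).prod (((ContinuousLinearMap.fst ℝ _ _).comp
      (ContinuousLinearMap.snd ℝ _ _)).prod
        ((ContinuousLinearMap.snd ℝ _ _).comp (ContinuousLinearMap.snd ℝ _ _) +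
          constMapL.comp ((ContinuousLinearMap.fst ℝ _ _).comp (ContinuousLinearMap.snd ℝ _ _)) +
          B.comp (ContinuousLinearMap.fst ℝ _ _)))
  have hB : ∀ v, B v = ∑ i, v i • primitiveL (superposition (g i) (hg i).continuous γ) := by
    intro v
    simp [B]
  have hG : ∀ v, G v = (v.1, v.2.1, v.2.2 + constMapL v.2.1 + B v.1) := fun v => rfl
  have hD : ∀ v, fderiv ℝ (trajectoryMap g hg) (0, c, γ) v =
      (v.1, v.2.1, v.2.2 - constMapL v.2.1 - B v.1) := by
    intro v
    rw [fderiv_trajectoryMap, hB]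
    simp
  refine ⟨ContinuousLinearEquiv.equivOfInverse (fderiv ℝ (trajectoryMap g hg) (0, c, γ)) G
    (fun v => ?_) (fun v => ?_), ?_⟩
  · rw [hG, hD]
    exact Prod.ext rfl (Prod.ext rfl (by simp only; abel))
  · rw [hG, hD]
    exact Prod.ext rfl (Prod.ext rfl (by simp only; abel))
  · exact ((contDiff_trajectoryMap g hg).differentiable (by simp) _).hasFDerivAt

/-- Along a trajectory `γ` of `∑ s_j g_j`, where the `g_j` commute, `τ ↦ τ g_i(γ(τ))` solves the
linearized equation. -/
theorem trajectory_variation (g : Fin m → E → E) (hg : ∀ i, ContDiff ℝ ∞ (g i))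
    {s : Fin m → ℝ} {c : E} {γ : C(unitInterval, E)}
    (hγ : (trajectoryMap g hg (s, c, γ)).2.2 = 0) (i : Fin m)
    (hcomm : ∀ j τ, fderiv ℝ (g i) (γ τ) (g j (γ τ)) = fderiv ℝ (g j) (γ τ) (g i (γ τ))) :
    fderiv ℝ (trajectoryMap g hg) (s, c, γ) (Pi.single i 1, 0,
      ⟨fun τ => (τ : ℝ) • g i (γ τ), by
        have := (hg i).continuous
        fun_prop⟩) = (Pi.single i 1, 0, 0) := by
  set γ' : ℝ → E := fun σ => γ (projIcc 0 1 zero_le_one σ) with hγ'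
  have hγ'c : Continuous γ' := γ.continuous.comp continuous_projIcc
  have hgc : ∀ j, Continuous fun σ => g j (γ' σ) := fun j => (hg j).continuous.comp hγ'c
  -- The right-hand side of the integral equation extends γ from the unit interval to a
  -- differentiable curve on the line.
  set δ : ℝ → E := fun τ => c + ∑ j, s j • ∫ σ in (0 : ℝ)..τ, g j (γ' σ) with hδ
  have hδγ : ∀ τ : unitInterval, δ τ = γ τ := by
    intro τ
    have h := DFunLike.congr_fun hγ τ
    simp only [trajectoryMap, ContinuousMap.sub_apply, constMapL_apply, ContinuousMap.zero_apply,
      ContinuousMap.coe_sum, Finset.sum_apply, ContinuousMap.smul_apply,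
      primitiveL_apply, superposition_apply] at h
    rw [sub_sub, sub_eq_zero] at h
    exact h.symm
  have hδd : ∀ τ, HasDerivAt δ (∑ j, s j • g j (γ' τ)) τ := fun τ =>
    (HasDerivAt.fun_sum fun j _ => ((hgc j).integral_hasStrictDerivAt 0 τ).hasDerivAt.const_smul
      (s j)).const_add c
  have hvar : ∀ σ ∈ Icc (0 : ℝ) 1, HasDerivAt (fun σ : ℝ => σ • g i (δ σ))
      (g i (γ' σ) + ∑ j, s j • fderiv ℝ (g j) (γ' σ) (σ • g i (γ' σ))) σ := by
    intro σ hσ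
    have h1 : δ σ = γ' σ := by
      rw [hδγ ⟨σ, hσ⟩, hγ']
      simp only [projIcc_of_mem zero_le_one hσ]
    have h2 := (((hg i).differentiable (by simp)) (δ σ)).hasFDerivAt.comp_hasDerivAt σ (hδd σ)
    have h3 := (hasDerivAt_id σ).smul h2
    refine h3.congr_deriv ?_
    simp only [id, one_smul, h1, map_sum, map_smul, Finset.smul_sum, Function.comp]
    rw [add_comm]
    congr 1
    refine Finset.sum_congr rfl fun j _ => ?_
    rw [hγ', hcomm j, smul_comm]
  rw [fderiv_trajectoryMap]
  refine Prod.ext rfl (Prod.ext rfl ?_)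
  ext τ
  have hDc : ∀ j, Continuous fun σ => s j • fderiv ℝ (g j) (γ' σ) (σ • g i (γ' σ)) := fun j =>
    ((((hg j).continuous_fderiv (by simp)).comp hγ'c).clm_apply
      (continuous_id.smul (hgc i))).const_smul (s j)
  have hDs : Continuous fun σ => ∑ j, s j • fderiv ℝ (g j) (γ' σ) (σ • g i (γ' σ)) :=
    continuous_finsetSum _ fun j _ => hDc j
  have hint := intervalIntegral.integral_eq_sub_of_hasDerivAt (a := 0) (b := (τ : ℝ))
    (fun σ hσ => hvar σ (by
      rw [uIcc_of_le τ.2.1] at hσ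
      exact ⟨hσ.1, hσ.2.trans τ.2.2⟩))
    (((hgc i).add hDs).intervalIntegrable _ _)
  rw [intervalIntegral.integral_add ((hgc i).intervalIntegrable _ _)
    (hDs.intervalIntegrable _ _), intervalIntegral.integral_finsetSum
      (fun j _ => (hDc j).intervalIntegrable _ _)] at hint
  simp only [intervalIntegral.integral_smul, hδγ, zero_smul, sub_zero] at hint
  have hproj : ∀ σ ∈ uIcc (0 : ℝ) τ, ((projIcc 0 1 zero_le_one σ : unitInterval) : ℝ) = σ := by
    intro σ hσ
    rw [uIcc_of_le τ.2.1] at hσ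
    rw [projIcc_of_mem zero_le_one ⟨hσ.1, hσ.2.trans τ.2.2⟩]
  have hint' : ∀ j, ∫ σ in (0 : ℝ)..τ, fderiv ℝ (g j) (γ' σ)
      (((projIcc 0 1 zero_le_one σ : unitInterval) : ℝ) • g i (γ' σ)) =
      ∫ σ in (0 : ℝ)..τ, fderiv ℝ (g j) (γ' σ) (σ • g i (γ' σ)) := fun j =>
    intervalIntegral.integral_congr fun σ hσ => by simp only [hproj σ hσ]
  simp only [ContinuousMap.sub_apply, constMapL_apply, ContinuousMap.zero_apply,
    ContinuousMap.coe_sum, Finset.sum_apply, ContinuousMap.add_apply, ContinuousMap.smul_apply,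
    primitiveL_apply, superposition_apply, pointwiseApply_apply, ContinuousMap.coe_mk]
  change _ - _ - ∑ j, (s j • (∫ σ in (0 : ℝ)..τ, fderiv ℝ (g j) (γ' σ)
      (((projIcc 0 1 zero_le_one σ : unitInterval) : ℝ) • g i (γ' σ))) + _) = _
  simp only [hint', Finset.sum_add_distrib]
  rw [Finset.sum_eq_single (f := fun x => (Pi.single i 1 : Fin m → ℝ) x • _) i
    (fun j _ hj => by rw [Pi.single_eq_of_ne hj, zero_smul]) (fun h => absurd (Finset.mem_univ i) h),
    Pi.single_eq_same, one_smul, sub_zero, add_comm, sub_eq_zero]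
  exact hint.symm

/-- Commuting vector fields have a joint flow, smooth in the times and the initial point. -/
theorem exists_joint_flow [FiniteDimensional ℝ E] {D : Set E} (hD : IsOpen D) {Z : Fin m → E → E}
    (hZ : ∀ i, ContDiffOn ℝ ∞ (Z i) D)
    (hcomm : ∀ i j, ∀ p ∈ D, lieBracket ℝ (Z i) (Z j) p = 0) {p₀ : E} (hp₀ : p₀ ∈ D) :
    ∃ (W : Set ((Fin m → ℝ) × E)) (Ψ : (Fin m → ℝ) × E → E), IsOpen W ∧ (0, p₀) ∈ W ∧
      ContDiffOn ℝ ∞ Ψ W ∧ MapsTo Ψ W D ∧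
      (∀ z ∈ W, ∀ i, fderiv ℝ Ψ z (Pi.single i 1, 0) = Z i (Ψ z)) ∧
      ∀ c, (0, c) ∈ W → Ψ (0, c) = c := by
  obtain ⟨ρ, hρ, hρD, hext⟩ := exists_contDiff_eqOn_ball hD hp₀
  choose g hg hgZ using fun i => hext (hZ i)
  set γ₀ : C(unitInterval, E) := constMapL p₀
  obtain ⟨A, hA⟩ := exists_equiv_hasFDerivAt_trajectoryMap g hg p₀ γ₀
  -- Only curves inside the ball are admitted: there the extensions `g i` equal `Z i`, and so they
  -- commute.
  have hO : IsOpen {z : (Fin m → ℝ) × E × C(unitInterval, E) |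
      MapsTo z.2.2 univ (Metric.ball p₀ ρ)} :=
    (ContinuousMap.isOpen_setOfPred_mapsTo isCompact_univ Metric.isOpen_ball).preimage
      (continuous_snd.comp continuous_snd)
  obtain ⟨e, hae, hesub, hee, hesymm, hinv⟩ :=
    (contDiff_trajectoryMap g hg).contDiffOn.exists_openPartialHomeomorph hO
      (a := (0, p₀, γ₀)) (fun τ _ => Metric.mem_ball_self hρ) A hA
  have hz₀ : trajectoryMap g hg (0, p₀, γ₀) = (0, p₀, 0) := by
    refine Prod.ext rfl (Prod.ext rfl ?_)
    simp [trajectoryMap, γ₀]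
  let ι : (Fin m → ℝ) × E →L[ℝ] (Fin m → ℝ) × E × C(unitInterval, E) :=
    (ContinuousLinearMap.fst ℝ _ _).prod ((ContinuousLinearMap.snd ℝ _ _).prod 0)
  -- The flow is the endpoint at time 1 of the trajectory of $\sum_i s_iZ_i$ starting at `c`.
  let ev : C(unitInterval, E) →L[ℝ] E := ContinuousMap.evalCLM ℝ (1 : unitInterval)
  let Γ : (Fin m → ℝ) × E → C(unitInterval, E) := fun z => (e.symm (ι z)).2.2
  have hι : ∀ z, ι z = (z.1, z.2, 0) := fun z => rfl
  have hev : ∀ γ, ev γ = γ 1 := fun γ => rfl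
  have hWo : IsOpen (ι ⁻¹' e.target) := e.open_target.preimage ι.continuous
  have hsm : ContDiffOn ℝ ∞ (fun z => e.symm (ι z)) (ι ⁻¹' e.target) :=
    hesymm.comp ι.contDiff.contDiffOn (mapsTo_preimage _ _)
  have hsymm : ∀ z ∈ ι ⁻¹' e.target, e.symm (ι z) = (z.1, z.2, Γ z) := by
    intro z hz
    have h := e.right_inv hz
    rw [hee] at h
    have h1 : (e.symm (ι z)).1 = z.1 := congrArg Prod.fst h
    have h2 : (e.symm (ι z)).2.1 = z.2 := congrArg (fun x => x.2.1) h
    exact Prod.ext h1 (Prod.ext h2 rfl)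
  have hΓ : ∀ z ∈ ι ⁻¹' e.target, trajectoryMap g hg (z.1, z.2, Γ z) = (z.1, z.2, 0) := by
    intro z hz
    rw [← hsymm z hz, ← hee, e.right_inv hz, hι]
  have hΓs : ∀ z ∈ ι ⁻¹' e.target, (z.1, z.2, Γ z) ∈ e.source := by
    intro z hz
    rw [← hsymm z hz]
    exact e.map_target hz
  have hball : ∀ z ∈ ι ⁻¹' e.target, ∀ τ, Γ z τ ∈ Metric.ball p₀ ρ := fun z hz τ =>
    hesub (hΓs z hz) (mem_univ τ)
  refine ⟨ι ⁻¹' e.target, fun z => ev (Γ z), hWo, ?_, ?_, ?_, ?_, ?_⟩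
  · have := e.map_source hae
    rwa [hee, hz₀] at this
  · exact ev.contDiff.comp_contDiffOn hsm.snd.snd
  · exact fun z hz => hρD (hball z hz 1)
  · intro z hz i
    have hd : HasFDerivAt (fun z => e.symm (ι z)) (fderiv ℝ (fun z => e.symm (ι z)) z) z :=
      ((hsm.contDiffAt (hWo.mem_nhds hz)).differentiableAt (by simp)).hasFDerivAt
    have hdΓ : HasFDerivAt (fun z => ev (Γ z)) _ z := ev.hasFDerivAt.comp z hd.snd.snd
    obtain ⟨B, hB⟩ := hinv _ (hΓs z hz)
    have hid : HasFDerivAt (fun z => e (e.symm (ι z))) ι z := by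
      refine ι.hasFDerivAt.congr_of_eventuallyEq ?_
      filter_upwards [hWo.mem_nhds hz] with y hy using e.right_inv hy
    have hB' : HasFDerivAt e (B : _ →L[ℝ] _) (e.symm (ι z)) := by
      rw [hsymm z hz]
      exact hB.congr_of_eventuallyEq (Eventually.of_forall hee)
    have h1 := DFunLike.congr_fun (hid.unique (hB'.comp z hd)) (Pi.single i 1, 0)
    have h2 := trajectory_variation g hg (congrArg (fun x => x.2.2) (hΓ z hz)) i (by
      intro j τ
      have hcm := hcomm i j (Γ z τ) (hρD (hball z hz τ))
      have hnhds := Metric.isOpen_ball.mem_nhds (hball z hz τ)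
      rw [lieBracket_apply, ← ((hgZ i).eventuallyEq_of_mem hnhds).fderiv_eq,
        ← ((hgZ j).eventuallyEq_of_mem hnhds).fderiv_eq, ← hgZ i (hball z hz τ),
        ← hgZ j (hball z hz τ), sub_eq_zero] at hcm
      exact hcm.symm)
    rw [hB.fderiv] at h2
    -- The derivative of the trajectory in $s_i$ and the curve $\tau\mapsto\tau g_i(\gamma(\tau))$
    -- have the same image under an invertible map. Evaluating at $\tau=1$ gives `Z i`.
    have h3 := B.injective (h1.symm.trans h2.symm)
    rw [hdΓ.fderiv]
    have h4 := congrArg (fun x => ev x.2.2) h3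
    refine h4.trans ?_
    rw [hev, ContinuousMap.coe_mk, Icc.coe_one, one_smul]
    exact hgZ i (hball z hz 1)
  · intro c hc
    have h := congrArg (fun x => ev x.2.2) (hΓ _ hc)
    simp only [trajectoryMap, hev] at h
    simp only [hev]
    simpa [sub_eq_zero] using h

end Flow

/-! ### Simultaneous straightening of commuting fields. -/

section Straightening

/-- `(t, s^i, s^α) ↦ s^i`. -/
def abelianPartL (m n : ℕ) : Base (Fin m ⊕ Fin n) →L[ℝ] (Fin m → ℝ) :=
  ContinuousLinearMap.pi fun i =>
    (ContinuousLinearMap.proj (R := ℝ) (φ := fun _ : Fin m ⊕ Fin n => ℝ) (Sum.inl i)).comp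
      (ContinuousLinearMap.snd ℝ _ _)

/-- `toReducedBase` as a continuous linear map. -/
def toReducedBaseL (m n : ℕ) : Base (Fin m ⊕ Fin n) →L[ℝ] Base (Fin n) :=
  (ContinuousLinearMap.fst ℝ _ _).prod (ContinuousLinearMap.pi fun β =>
    (ContinuousLinearMap.proj (R := ℝ) (φ := fun _ : Fin m ⊕ Fin n => ℝ) (Sum.inr β)).comp
      (ContinuousLinearMap.snd ℝ _ _))

theorem abelianPartL_apply {m n : ℕ} (p : Base (Fin m ⊕ Fin n)) (i : Fin m) :
    abelianPartL m n p i = p.2 (Sum.inl i) := rfl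

theorem ext_abelianPart {m n : ℕ} {p q : Base (Fin m ⊕ Fin n)}
    (h₁ : abelianPartL m n p = abelianPartL m n q)
    (h₂ : toReducedBaseL m n p = toReducedBaseL m n q) : p = q := by
  have h₃ : p.1 = q.1 := (Prod.ext_iff.1 h₂).1
  refine Prod.ext h₃ (funext fun μ => ?_)
  rcases μ with i | β
  · exact congrFun h₁ i
  · exact congrFun (Prod.ext_iff.1 h₂).2 β

/-- Linearly independent vectors extend to a linear coordinate system. -/
theorem exists_linear_complement {ι : Type} [Fintype ι] {m n : ℕ}
    (hcard : Fintype.card ι = m + n) {v : Fin m → Base ι} (hv : LinearIndependent ℝ v) :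
    ∃ (q : Base (Fin n) →L[ℝ] Base ι) (L : Base (Fin m ⊕ Fin n) ≃L[ℝ] Base ι),
      ∀ p, L p = ∑ i, abelianPartL m n p i • v i + q (toReducedBaseL m n p) := by
  obtain ⟨Q, hQ⟩ := Submodule.exists_isCompl (Submodule.span ℝ (range v))
  have hspan : Module.finrank ℝ (Submodule.span ℝ (range v)) = m := by
    rw [finrank_span_eq_card hv, Fintype.card_fin]
  have hfr := Submodule.finrank_add_eq_of_isCompl hQ
  have hB : Module.finrank ℝ (Base ι) = 1 + (m + n) := by simp [hcard]
  have hQr : Module.finrank ℝ (Base (Fin n)) = Module.finrank ℝ Q := by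
    have : Module.finrank ℝ (Base (Fin n)) = 1 + n := by simp
    omega
  let e : Base (Fin n) ≃ₗ[ℝ] Q := LinearEquiv.ofFinrankEq _ _ hQr
  let q : Base (Fin n) →L[ℝ] Base ι := LinearMap.toContinuousLinearMap (Q.subtype.comp e.toLinearMap)
  have hq : ∀ b, q b = e b := fun b => rfl
  let L₀ : Base (Fin m ⊕ Fin n) →ₗ[ℝ] Base ι :=
    (Fintype.linearCombination ℝ v).comp (abelianPartL m n).toLinearMap +
      q.toLinearMap.comp (toReducedBaseL m n).toLinearMap
  have hL₀ : ∀ p, L₀ p = ∑ i, abelianPartL m n p i • v i + q (toReducedBaseL m n p) := by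
    intro p
    simp [L₀, Fintype.linearCombination_apply]
  have hinj : Function.Injective L₀ := by
    rw [← LinearMap.ker_eq_bot, LinearMap.ker_eq_bot']
    intro p hp
    rw [hL₀] at hp
    have h1 : ∑ i, abelianPartL m n p i • v i ∈ Submodule.span ℝ (range v) :=
      Submodule.sum_mem _ fun i _ => Submodule.smul_mem _ _ (Submodule.subset_span ⟨i, rfl⟩)
    have h2 : q (toReducedBaseL m n p) ∈ Q := (e _).2
    have h3 : ∑ i, abelianPartL m n p i • v i = 0 := by
      refine Submodule.disjoint_def.1 hQ.disjoint _ h1 ?_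
      rw [eq_neg_of_add_eq_zero_left hp]
      exact Q.neg_mem h2
    rw [h3, zero_add, hq, Submodule.coe_eq_zero, LinearEquiv.map_eq_zero_iff] at hp
    refine ext_abelianPart (funext fun i => ?_) (hp.trans (map_zero _).symm)
    rw [map_zero]
    exact Fintype.linearIndependent_iff.1 hv _ h3 i
  have hfin : Module.finrank ℝ (Base (Fin m ⊕ Fin n)) = Module.finrank ℝ (Base ι) := by
    rw [hB]; simp
  exact ⟨q, (L₀.linearEquivOfInjective hinj hfin).toContinuousLinearEquiv, hL₀⟩

/-- Commuting linearly independent vector fields can be straightened simultaneously. -/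
theorem exists_isNormalForm {ι : Type} [Fintype ι] {m n : ℕ} (hcard : Fintype.card ι = m + n)
    {D : Set (Base ι)} (hD : IsOpen D) {Z : Fin m → Base ι → Base ι}
    (hZ : ∀ i, ContDiffOn ℝ ∞ (Z i) D)
    (hcomm : ∀ i j, ∀ p ∈ D, lieBracket ℝ (Z i) (Z j) p = 0) {p₀ : Base ι} (hp₀ : p₀ ∈ D)
    (hind : LinearIndependent ℝ fun i => Z i p₀) :
    ∃ Φ : OpenPartialHomeomorph (Base ι) (Base (Fin m ⊕ Fin n)),
      p₀ ∈ Φ.source ∧ IsNormalForm D Z Φ := by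
  obtain ⟨W, Ψ, hW, h0W, hΨ, hΨD, hΨZ, hΨ0⟩ := exists_joint_flow hD hZ hcomm hp₀
  obtain ⟨q, L, hL⟩ := exists_linear_complement (n := n) hcard hind
  let aL : Base (Fin m ⊕ Fin n) →L[ℝ] (Fin m → ℝ) × Base ι :=
    (abelianPartL m n).prod (q.comp (toReducedBaseL m n))
  -- The variables $s^i$ are flow times, and $(t,s^\alpha)$ parametrize through `q` an affine slice
  -- at `p₀` transversal to the fields.
  let a : Base (Fin m ⊕ Fin n) → (Fin m → ℝ) × Base ι := fun p => (0, p₀) + aL p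
  have haL : ∀ p, HasFDerivAt a aL p := fun p => aL.hasFDerivAt.const_add _
  have hac : ContDiff ℝ ∞ a := contDiff_const.add aL.contDiff
  have ha0 : a 0 = (0, p₀) := by simp [a]
  have hU : IsOpen (a ⁻¹' W) := hW.preimage hac.continuous
  have h0U : (0 : Base (Fin m ⊕ Fin n)) ∈ a ⁻¹' W := by
    rw [mem_preimage, ha0]; exact h0W
  have hf : ContDiffOn ℝ ∞ (fun p => Ψ (a p)) (a ⁻¹' W) :=
    hΨ.comp hac.contDiffOn (mapsTo_preimage _ _)
  have hdΨ : ∀ z ∈ W, HasFDerivAt Ψ (fderiv ℝ Ψ z) z := fun z hz =>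
    ((hΨ.contDiffAt (hW.mem_nhds hz)).differentiableAt (by simp)).hasFDerivAt
  have hdf : ∀ p ∈ a ⁻¹' W, HasFDerivAt (fun p => Ψ (a p)) ((fderiv ℝ Ψ (a p)).comp aL) p :=
    fun p hp => (hdΨ _ hp).comp p (haL p)
  -- At zero times the flow is the identity in the initial point.
  have hdc : ∀ b, fderiv ℝ Ψ (0, p₀) (0, b) = b := by
    intro b
    have h1 : HasFDerivAt (fun c : Base ι => ((0, c) : (Fin m → ℝ) × Base ι))
        (ContinuousLinearMap.inr ℝ _ _) p₀ := hasFDerivAt_prodMk_right _ _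
    have h2 := (hdΨ _ h0W).comp p₀ h1
    have h3 : HasFDerivAt (Ψ ∘ fun c : Base ι => ((0, c) : (Fin m → ℝ) × Base ι))
        (ContinuousLinearMap.id ℝ _) p₀ := by
      refine (hasFDerivAt_id p₀).congr_of_eventuallyEq ?_
      filter_upwards [h1.continuousAt.eventually_mem (hW.mem_nhds h0W)] with c hc using hΨ0 c hc
    exact DFunLike.congr_fun (h2.unique h3) b
  have hdL : (fderiv ℝ Ψ (a 0)).comp aL = (L : _ →L[ℝ] _) := by
    refine ContinuousLinearMap.ext fun p => ?_
    have : aL p = ∑ i, abelianPartL m n p i • ((Pi.single i 1 : Fin m → ℝ), (0 : Base ι)) +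
        (0, q (toReducedBaseL m n p)) := by
      refine Prod.ext ?_ ?_
      · ext j
        simp [aL, Prod.fst_sum, Finset.sum_apply, Pi.single_apply]
      · simp [aL, Prod.snd_sum]
    rw [ha0, ContinuousLinearMap.comp_apply, this, map_add, map_sum, hdc]
    simp only [map_smul, hΨZ _ h0W, hΨ0 _ h0W]
    exact (hL p).symm
  obtain ⟨e, h0e, heU, hef, hesymm, -⟩ := hf.exists_openPartialHomeomorph hU h0U L
    (by rw [← hdL]; exact hdf 0 h0U)
  refine ⟨e.symm, ?_, ?_, ?_, hesymm, ?_, ?_⟩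
  · have := e.map_source h0e
    rwa [hef, ha0, hΨ0 _ h0W] at this
  · exact ⟨_, e.map_source h0e⟩
  · intro y hy
    have hy' := e.map_target hy
    have := hΨD (heU hy')
    rwa [← hef, e.right_inv hy] at this
  · exact (hf.mono heU).congr fun x _ => hef x
  · intro i p hp
    have hde : HasFDerivAt e ((fderiv ℝ Ψ (a p)).comp aL) p :=
      (hdf p (heU hp)).congr_of_eventuallyEq (Eventually.of_forall hef)
    have hds : HasFDerivAt e.symm (fderiv ℝ e.symm (e p)) (e p) :=
      ((hesymm.contDiffAt (e.open_target.mem_nhds (e.map_source hp))).differentiableAt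
        (by simp)).hasFDerivAt
    have hid : HasFDerivAt (e.symm ∘ e) (ContinuousLinearMap.id ℝ _) p := by
      refine (hasFDerivAt_id p).congr_of_eventuallyEq ?_
      filter_upwards [e.open_source.mem_nhds hp] with y hy using e.left_inv hy
    have h1 := DFunLike.congr_fun ((hds.comp p hde).unique hid) (0, Pi.single (Sum.inl i) 1)
    have h2 : aL (0, Pi.single (Sum.inl i) 1) = (Pi.single i 1, 0) := by
      refine Prod.ext ?_ ?_
      · ext j
        simp [aL, abelianPartL_apply, Pi.single_apply]
      · have : toReducedBaseL m n (0, Pi.single (Sum.inl i) 1) = 0 :=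
          Prod.ext rfl (funext fun β => by simp [toReducedBaseL])
        simp [aL, this]
    simp only [ContinuousLinearMap.comp_apply, h2, hΨZ _ (heU hp)] at h1
    simp only [transformField, OpenPartialHomeomorph.symm_symm, hef] at h1 ⊢
    exact h1

end Straightening

/-! ### Derivatives of prolongations and of lifted maps. -/

section Jets

variable {ι κ : Type} [Fintype ι] [Fintype κ] {F : Type} [NormedAddCommGroup F] [NormedSpace ℝ F]

/-- `toBase` as a continuous linear map. -/
def toBaseL (ι : Type) [Fintype ι] : Jet ι →L[ℝ] Base ι :=
  (ContinuousLinearMap.fst ℝ _ _).prod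
    ((ContinuousLinearMap.fst ℝ _ _).comp (ContinuousLinearMap.snd ℝ _ _))

/-- The jet coordinates `ẏ^μ`. -/
def velocityL (ι : Type) [Fintype ι] : Jet ι →L[ℝ] (ι → ℝ) :=
  (ContinuousLinearMap.snd ℝ _ _).comp (ContinuousLinearMap.snd ℝ _ _)

theorem toBaseL_apply (q : Jet ι) : toBaseL ι q = toBase q := rfl

theorem velocityL_apply (q : Jet ι) : velocityL ι q = q.2.2 := rfl

theorem continuous_toBase : Continuous (toBase : Jet ι → Base ι) := (toBaseL ι).continuous

theorem hasFDerivAt_toBase (q : Jet ι) : HasFDerivAt toBase (toBaseL ι) q := (toBaseL ι).hasFDerivAt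

theorem isOpenMap_toBase : IsOpenMap (toBase : Jet ι → Base ι) := by
  refine (toBaseL ι).isOpenMap fun p => ⟨(p.1, p.2, 0), rfl⟩

theorem ContDiffAt.isSymmSndFDerivAt_of_infty {E : Type*} [NormedAddCommGroup E] [NormedSpace ℝ E]
    {f : E → F} {x : E} (hf : ContDiffAt ℝ ∞ f x) : IsSymmSndFDerivAt ℝ f x :=
  (contDiffAt_infty.1 hf 2).isSymmSndFDerivAt (by simp)

theorem ContDiffAt.comp_toBase {n : WithTop ℕ∞} {f : Base ι → F} {q : Jet ι}
    (hf : ContDiffAt ℝ n f (toBase q)) : ContDiffAt ℝ n (fun q => f (toBase q)) q :=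
  ContDiffAt.comp (g := f) q hf (toBaseL ι).contDiff.contDiffAt

theorem ContDiffAt.totalDeriv {f : Base ι → F} {q : Jet ι} (hf : ContDiffAt ℝ ∞ f (toBase q)) :
    ContDiffAt ℝ ∞ (totalDeriv f) q :=
  (hf.fderiv_right (m := ∞) (by simp)).comp_toBase.clm_apply
    (contDiffAt_const.prodMk (velocityL ι).contDiff.contDiffAt)

theorem fderiv_totalDeriv {f : Base ι → F} {q : Jet ι} (hf : ContDiffAt ℝ ∞ f (toBase q))
    (v : Jet ι) : fderiv ℝ (totalDeriv f) q v =
      fderiv ℝ (fderiv ℝ f) (toBase q) (toBase v) (1, q.2.2) +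
        fderiv ℝ f (toBase q) (0, v.2.2) := by
  have h1 : HasFDerivAt (fderiv ℝ f) (fderiv ℝ (fderiv ℝ f) (toBase q)) (toBase q) :=
    ((hf.fderiv_right (m := ∞) (by simp)).differentiableAt (by simp)).hasFDerivAt
  have h2 : HasFDerivAt (fun q : Jet ι => ((1 : ℝ), q.2.2))
      ((0 : Jet ι →L[ℝ] ℝ).prod (velocityL ι)) q :=
    (hasFDerivAt_const (1 : ℝ) q).prodMk (velocityL ι).hasFDerivAt
  have h3 : HasFDerivAt (totalDeriv f) _ q := (h1.comp q (hasFDerivAt_toBase q)).clm_apply h2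
  rw [h3.fderiv]
  exact add_comm _ _

theorem ContDiffAt.prolong {Z : Base ι → Base ι} {q : Jet ι} (hZ : ContDiffAt ℝ ∞ Z (toBase q)) :
    ContDiffAt ℝ ∞ (prolong Z) q :=
  hZ.comp_toBase.fst.prodMk (hZ.comp_toBase.snd.prodMk
    (hZ.totalDeriv.snd.sub (hZ.totalDeriv.fst.smul (velocityL ι).contDiff.contDiffAt)))

theorem fderiv_prolong {Z : Base ι → Base ι} {q : Jet ι} (hZ : ContDiffAt ℝ ∞ Z (toBase q))
    (v : Jet ι) : fderiv ℝ (prolong Z) q v =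
      ((fderiv ℝ Z (toBase q) (toBase v)).1, (fderiv ℝ Z (toBase q) (toBase v)).2,
        (fderiv ℝ (totalDeriv Z) q v).2 - ((fderiv ℝ (totalDeriv Z) q v).1 • q.2.2 +
          (totalDeriv Z q).1 • v.2.2)) := by
  have h1 : HasFDerivAt (fun q => Z (toBase q)) _ q :=
    (hZ.differentiableAt (by simp)).hasFDerivAt.comp q (hasFDerivAt_toBase q)
  have h2 := (hZ.totalDeriv.differentiableAt (by simp)).hasFDerivAt
  have h3 : HasFDerivAt (prolong Z) _ q :=
    h1.fst.prodMk (h1.snd.prodMk (h2.snd.sub (h2.fst.smul (velocityL ι).hasFDerivAt)))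
  rw [h3.fderiv]
  simp [velocityL_apply, toBaseL_apply, add_comm]

theorem toBase_prolong (Z : Base ι → Base ι) (q : Jet ι) : toBase (prolong Z q) = Z (toBase q) :=
  rfl

/-- Written as a vector in the base, the velocity part can be fed to Fréchet derivatives without
splitting it into components. -/
theorem prolong_velocity (Z : Base ι → Base ι) (q : Jet ι) :
    ((0, (prolong Z q).2.2) : Base ι) = totalDeriv Z q - (totalDeriv Z q).1 • (1, q.2.2) := by
  ext <;> simp [prolong]

/-- Prolongation is a homomorphism of Lie algebras. -/
theorem lieBracket_prolong {Z W : Base ι → Base ι} {q : Jet ι}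
    (hZ : ContDiffAt ℝ ∞ Z (toBase q)) (hW : ContDiffAt ℝ ∞ W (toBase q)) :
    lieBracket ℝ (prolong Z) (prolong W) q = prolong (lieBracket ℝ Z W) q := by
  have hd : ∀ {X : Base ι → Base ι}, ContDiffAt ℝ ∞ X (toBase q) →
      HasFDerivAt X (fderiv ℝ X (toBase q)) (toBase q) ∧
      HasFDerivAt (fderiv ℝ X) (fderiv ℝ (fderiv ℝ X) (toBase q)) (toBase q) ∧
      IsSymmSndFDerivAt ℝ X (toBase q) := fun hX =>
    ⟨(hX.differentiableAt (by simp)).hasFDerivAt,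
      ((hX.fderiv_right (m := ∞) (by simp)).differentiableAt (by simp)).hasFDerivAt,
      hX.isSymmSndFDerivAt_of_infty⟩
  obtain ⟨hZ1, hZ2, hZs⟩ := hd hZ
  obtain ⟨hW1, hW2, hWs⟩ := hd hW
  have hB : totalDeriv (lieBracket ℝ Z W) q =
      (fderiv ℝ (fderiv ℝ W) (toBase q) (1, q.2.2) (Z (toBase q)) +
        fderiv ℝ W (toBase q) (totalDeriv Z q)) -
      (fderiv ℝ (fderiv ℝ Z) (toBase q) (1, q.2.2) (W (toBase q)) +
        fderiv ℝ Z (toBase q) (totalDeriv W q)) := by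
    have : HasFDerivAt (lieBracket ℝ Z W) _ (toBase q) :=
      (hW2.clm_apply hZ1).sub (hZ2.clm_apply hW1)
    rw [totalDeriv, this.fderiv]
    simp [totalDeriv, add_comm]
  -- Symmetry of the second derivatives of $Z$ and $W$ matches those terms with the ones in `hB`;
  -- what remains is linear algebra in the first derivatives.
  rw [lieBracket_apply, fderiv_prolong hW, fderiv_prolong hZ, fderiv_totalDeriv hW,
    fderiv_totalDeriv hZ, toBase_prolong, toBase_prolong, prolong_velocity, prolong_velocity,
    map_sub, map_sub, map_smul, map_smul, hZs.eq, hWs.eq]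
  conv_rhs => rw [prolong, hB, lieBracket_apply]
  change _ = (_, _, _)
  have hZV : fderiv ℝ Z (toBase q) (1, q.2.2) = totalDeriv Z q := rfl
  have hWV : fderiv ℝ W (toBase q) (1, q.2.2) = totalDeriv W q := rfl
  rw [hZV, hWV]
  refine Prod.ext (by simp) (Prod.ext (by simp) ?_)
  simp only [prolong, Prod.fst_sub, Prod.snd_sub, Prod.fst_add, Prod.snd_add, Prod.smul_fst,
    Prod.smul_snd, smul_eq_mul]
  module

theorem totalDeriv_sum_smul {M : Type*} [Fintype M] (c : M → ℝ) {Z : M → Base ι → F} {q : Jet ι}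
    (hZ : ∀ i, DifferentiableAt ℝ (Z i) (toBase q)) :
    totalDeriv (fun p => ∑ i, c i • Z i p) q = ∑ i, c i • totalDeriv (Z i) q := by
  have h : HasFDerivAt (fun p => ∑ i, c i • Z i p) (∑ i, c i • fderiv ℝ (Z i) (toBase q))
      (toBase q) := HasFDerivAt.fun_sum fun i _ => (hZ i).hasFDerivAt.const_smul (c i)
  rw [totalDeriv, h.fderiv]
  simp [totalDeriv, sum_apply]

theorem prolong_sum_smul {M : Type*} [Fintype M] (c : M → ℝ) {Z : M → Base ι → Base ι} {q : Jet ι}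
    (hZ : ∀ i, DifferentiableAt ℝ (Z i) (toBase q)) :
    prolong (fun p => ∑ i, c i • Z i p) q = ∑ i, c i • prolong (Z i) q := by
  rw [prolong, totalDeriv_sum_smul c hZ]
  refine Prod.ext ?_ (Prod.ext ?_ ?_)
  · simp [Prod.fst_sum, prolong]
  · simp [Prod.fst_sum, Prod.snd_sum, prolong]
  · simp [Prod.fst_sum, Prod.snd_sum, prolong, smul_sub, Finset.sum_smul, smul_smul]

theorem prolong_const (b : Base ι) (q : Jet ι) : prolong (fun _ => b) q = (b.1, b.2, 0) := by
  simp [prolong, totalDeriv]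

theorem Filter.EventuallyEq.prolong_eq {Z W : Base ι → Base ι} {q : Jet ι}
    (h : Z =ᶠ[𝓝 (toBase q)] W) : prolong Z q = prolong W q := by
  rw [prolong, prolong, totalDeriv, totalDeriv, h.fderiv_eq, h.self_of_nhds]

theorem ContDiffAt.jetLift {f : Base ι → Base κ} {q : Jet ι} (hf : ContDiffAt ℝ ∞ f (toBase q))
    (hq : (ODESymmetry.totalDeriv f q).1 ≠ 0) : ContDiffAt ℝ ∞ (jetLift f) q :=
  hf.comp_toBase.fst.prodMk (hf.comp_toBase.snd.prodMk
    ((hf.totalDeriv.fst.inv hq).smul hf.totalDeriv.snd))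

theorem fderiv_jetLift {f : Base ι → Base κ} {q : Jet ι} (hf : ContDiffAt ℝ ∞ f (toBase q))
    (hq : (totalDeriv f q).1 ≠ 0) (v : Jet ι) : fderiv ℝ (jetLift f) q v =
      ((fderiv ℝ f (toBase q) (toBase v)).1, (fderiv ℝ f (toBase q) (toBase v)).2,
        (totalDeriv f q).1⁻¹ • (fderiv ℝ (totalDeriv f) q v).2 -
          ((totalDeriv f q).1⁻¹ ^ 2 * (fderiv ℝ (totalDeriv f) q v).1) • (totalDeriv f q).2) := by
  have h1 : HasFDerivAt (fun q => f (toBase q)) _ q :=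
    (hf.differentiableAt (by simp)).hasFDerivAt.comp q (hasFDerivAt_toBase q)
  have h2 := (hf.totalDeriv.differentiableAt (by simp)).hasFDerivAt
  have h4 := (hasDerivAt_inv hq).comp_hasFDerivAt q h2.fst
  have h3 : HasFDerivAt (jetLift f) _ q :=
    h1.fst.prodMk (h1.snd.prodMk (h4.smul h2.snd))
  rw [h3.fderiv]
  refine Prod.ext rfl (Prod.ext rfl ?_)
  simp [sub_eq_add_neg]

theorem toBase_jetLift (f : Base ι → Base κ) (q : Jet ι) : toBase (jetLift f q) = f (toBase q) :=
  rfl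

theorem jetLift_velocity {f : Base ι → Base κ} {q : Jet ι} (hq : (totalDeriv f q).1 ≠ 0) :
    ((1, (jetLift f q).2.2) : Base κ) = (totalDeriv f q).1⁻¹ • totalDeriv f q := by
  ext <;> simp [jetLift, hq]

/-- Prolongation is compatible with changes of variables. -/
theorem prolong_jetLift {f : Base ι → Base κ} {q : Jet ι} (hf : ContDiffAt ℝ ∞ f (toBase q))
    (hq : (totalDeriv f q).1 ≠ 0) {Z : Base ι → Base ι} {Z' : Base κ → Base κ}
    (hZ : DifferentiableAt ℝ Z (toBase q)) (hZ' : DifferentiableAt ℝ Z' (f (toBase q)))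
    (h : ∀ᶠ x in 𝓝 (toBase q), Z' (f x) = fderiv ℝ f x (Z x)) :
    prolong Z' (jetLift f q) = fderiv ℝ (jetLift f) q (prolong Z q) := by
  have h1 := (hf.differentiableAt (by simp)).hasFDerivAt
  have h2 := ((hf.fderiv_right (m := ∞) (by simp)).differentiableAt (by simp)).hasFDerivAt
  have hs : IsSymmSndFDerivAt ℝ f (toBase q) := hf.isSymmSndFDerivAt_of_infty
  -- The relation $Z'\circ f=df\cdot Z$, differentiated along $(1,\dot y)$.
  have h3 := DFunLike.congr_fun ((hZ'.hasFDerivAt.comp _ h1).unique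
    ((h2.clm_apply hZ.hasFDerivAt).congr_of_eventuallyEq h)) (1, q.2.2)
  have h4 : fderiv ℝ Z' (f (toBase q)) (totalDeriv f q) =
      fderiv ℝ (fderiv ℝ f) (toBase q) (1, q.2.2) (Z (toBase q)) +
        fderiv ℝ f (toBase q) (totalDeriv Z q) := by
    rw [add_comm]; exact h3
  have h5 : totalDeriv Z' (jetLift f q) =
      (totalDeriv f q).1⁻¹ • fderiv ℝ Z' (f (toBase q)) (totalDeriv f q) := by
    rw [totalDeriv, jetLift_velocity hq, map_smul, toBase_jetLift]
  have hfV : fderiv ℝ f (toBase q) (1, q.2.2) = totalDeriv f q := rfl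
  have h6 : fderiv ℝ (totalDeriv f) q (prolong Z q) =
      (totalDeriv f q).1 • totalDeriv Z' (jetLift f q) -
        (totalDeriv Z q).1 • totalDeriv f q := by
    rw [fderiv_totalDeriv hf, toBase_prolong, prolong_velocity, map_sub, map_smul, hs.eq, h5,
      smul_inv_smul₀ hq, h4, hfV]
    abel
  rw [fderiv_jetLift hf hq, toBase_prolong, ← h.self_of_nhds, h6]
  refine Prod.ext rfl (Prod.ext rfl ?_)
  set b := totalDeriv Z' (jetLift f q)
  simp only [prolong, jetLift, Prod.fst_sub, Prod.snd_sub, Prod.smul_fst,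
    Prod.smul_snd, smul_eq_mul]
  change b.2 - b.1 • _ = _
  match_scalars <;> field_simp
  ring

theorem jetLift_leftInverse {f : Base ι → Base κ} {g : Base κ → Base ι} {q : Jet ι}
    (hf : DifferentiableAt ℝ f (toBase q)) (hg : DifferentiableAt ℝ g (f (toBase q)))
    (h : ∀ᶠ x in 𝓝 (toBase q), g (f x) = x) (hq : (totalDeriv f q).1 ≠ 0) :
    totalDeriv g (jetLift f q) = (totalDeriv f q).1⁻¹ • (1, q.2.2) ∧
      jetLift g (jetLift f q) = q := by
  have h1 : totalDeriv g (jetLift f q) = (totalDeriv f q).1⁻¹ • (1, q.2.2) := by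
    have := DFunLike.congr_fun ((hg.hasFDerivAt.comp _ hf.hasFDerivAt).unique
      ((hasFDerivAt_id _).congr_of_eventuallyEq h)) (1, q.2.2)
    rw [totalDeriv, jetLift_velocity hq, map_smul, toBase_jetLift]
    exact congrArg _ this
  refine ⟨h1, ?_⟩
  rw [ODESymmetry.jetLift, h1, toBase_jetLift, h.self_of_nhds]
  refine Prod.ext rfl (Prod.ext rfl ?_)
  simp [smul_smul, hq]

end Jets

/-! ### Changes of variables for systems and symmetries. -/

section Transport

variable {ι κ : Type} [Fintype ι] [Fintype κ]
  {Φ : OpenPartialHomeomorph (Base ι) (Base κ)}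

theorem transformField_apply_map {Z : Base ι → Base ι} {p : Base ι} (hp : p ∈ Φ.source) :
    transformField Φ Z (Φ p) = fderiv ℝ Φ p (Z p) := by
  rw [transformField, Φ.left_inv hp]

theorem transformField_sum_smul {M : Type*} [Fintype M] (c : M → ℝ) (Z : M → Base ι → Base ι) :
    transformField Φ (fun p => ∑ i, c i • Z i p) = fun p => ∑ i, c i • transformField Φ (Z i) p := by
  funext p
  simp [transformField]

theorem eventually_transformField {Z : Base ι → Base ι} {p : Base ι} (hp : p ∈ Φ.source) :
    ∀ᶠ x in 𝓝 p, transformField Φ Z (Φ x) = fderiv ℝ Φ x (Z x) := by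
  filter_upwards [Φ.open_source.mem_nhds hp] with x hx using transformField_apply_map hx

theorem ContDiffOn.contDiffAt_source (hΦ : ContDiffOn ℝ ∞ Φ Φ.source) {p : Base ι}
    (hp : p ∈ Φ.source) : ContDiffAt ℝ ∞ Φ p :=
  hΦ.contDiffAt (Φ.open_source.mem_nhds hp)

theorem ContDiffOn.contDiffAt_target (hΨ : ContDiffOn ℝ ∞ Φ.symm Φ.target) {p : Base κ}
    (hp : p ∈ Φ.target) : ContDiffAt ℝ ∞ Φ.symm p :=
  hΨ.contDiffAt (Φ.open_target.mem_nhds hp)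

theorem contDiffOn_transformField (hΦ : ContDiffOn ℝ ∞ Φ Φ.source)
    (hΨ : ContDiffOn ℝ ∞ Φ.symm Φ.target) {Z : Base ι → Base ι} (hZ : ContDiffOn ℝ ∞ Z Φ.source) :
    ContDiffOn ℝ ∞ (transformField Φ Z) Φ.target := by
  intro p hp
  have hp' := Φ.map_target hp
  have h1 : ContDiffAt ℝ ∞ (fun p => fderiv ℝ Φ (Φ.symm p)) p :=
    ContDiffAt.comp (g := fderiv ℝ Φ) p
      ((hΦ.contDiffAt_source hp').fderiv_right (m := ∞) (by simp)) (hΨ.contDiffAt_target hp)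
  have h2 : ContDiffAt ℝ ∞ (fun p => Z (Φ.symm p)) p :=
    ContDiffAt.comp (g := Z) p (hZ.contDiffAt (Φ.open_source.mem_nhds hp'))
      (hΨ.contDiffAt_target hp)
  exact (h1.clm_apply h2).contDiffWithinAt

theorem fderiv_symm_fderiv (hΦ : ContDiffOn ℝ ∞ Φ Φ.source)
    (hΨ : ContDiffOn ℝ ∞ Φ.symm Φ.target) {p : Base ι} (hp : p ∈ Φ.source) (v : Base ι) :
    fderiv ℝ Φ.symm (Φ p) (fderiv ℝ Φ p v) = v := by
  have h1 := ((hΦ.contDiffAt_source hp).differentiableAt (by simp)).hasFDerivAt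
  have h2 := ((hΨ.contDiffAt_target (Φ.map_source hp)).differentiableAt (by simp)).hasFDerivAt
  exact DFunLike.congr_fun ((h2.comp p h1).unique ((hasFDerivAt_id p).congr_of_eventuallyEq
    (Φ.eventually_left_inverse hp))) v

theorem lieBracket_transformField (hΦ : ContDiffOn ℝ ∞ Φ Φ.source)
    (hΨ : ContDiffOn ℝ ∞ Φ.symm Φ.target) {Z W : Base ι → Base ι}
    (hZ : ContDiffOn ℝ ∞ Z Φ.source) (hW : ContDiffOn ℝ ∞ W Φ.source) {p : Base κ}
    (hp : p ∈ Φ.target) :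
    lieBracket ℝ (transformField Φ Z) (transformField Φ W) p =
      fderiv ℝ Φ (Φ.symm p) (lieBracket ℝ Z W (Φ.symm p)) := by
  have hp' := Φ.map_target hp
  have hd : ∀ {X : Base ι → Base ι}, ContDiffOn ℝ ∞ X Φ.source →
      DifferentiableAt ℝ X (Φ.symm p) ∧
      DifferentiableAt ℝ (transformField Φ X) (Φ (Φ.symm p)) := fun hX =>
    ⟨(hX.contDiffAt (Φ.open_source.mem_nhds hp')).differentiableAt (by simp),
      ((contDiffOn_transformField hΦ hΨ hX).contDiffAt
        (Φ.open_target.mem_nhds (Φ.map_source hp'))).differentiableAt (by simp)⟩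
  have := lieBracket_of_related (contDiffAt_infty.1 (hΦ.contDiffAt_source hp') 2) (hd hZ).1
    (hd hW).1 (hd hZ).2 (hd hW).2 (eventually_transformField hp') (eventually_transformField hp')
  rwa [Φ.right_inv hp] at this

theorem isOpen_jetDomain (hΦ : ContDiffOn ℝ ∞ Φ Φ.source) {V : Set (Jet κ)} (hV : IsOpen V) :
    IsOpen {q : Jet ι | toBase q ∈ Φ.source ∧ (totalDeriv Φ q).1 ≠ 0 ∧ jetLift Φ q ∈ V} := by
  rw [isOpen_iff_mem_nhds]
  rintro q ⟨h1, h2, h3⟩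
  have hs := hΦ.contDiffAt_source h1
  filter_upwards [continuous_toBase.continuousAt.eventually_mem (Φ.open_source.mem_nhds h1),
    hs.totalDeriv.fst.continuousAt.eventually_ne h2,
    (hs.jetLift h2).continuousAt.eventually_mem (hV.mem_nhds h3)] with x hx1 hx2 hx3
    using ⟨hx1, hx2, hx3⟩

theorem isOpen_transformDomain (hΨ : ContDiffOn ℝ ∞ Φ.symm Φ.target) {U : Set (Jet ι)}
    (hU : IsOpen U) : IsOpen (transformDomain Φ U) :=
  isOpen_jetDomain (Φ := Φ.symm) hΨ hU

theorem jetLift_symm_jetLift (hΦ : ContDiffOn ℝ ∞ Φ Φ.source)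
    (hΨ : ContDiffOn ℝ ∞ Φ.symm Φ.target) {q : Jet ι} (hq : toBase q ∈ Φ.source)
    (hq' : (totalDeriv Φ q).1 ≠ 0) :
    toBase (jetLift Φ q) ∈ Φ.target ∧ (totalDeriv Φ.symm (jetLift Φ q)).1 ≠ 0 ∧
      jetLift Φ.symm (jetLift Φ q) = q := by
  have h := jetLift_leftInverse ((hΦ.contDiffAt_source hq).differentiableAt (by simp))
    ((hΨ.contDiffAt_target (Φ.map_source hq)).differentiableAt (by simp))
    (Φ.eventually_left_inverse hq) hq'
  refine ⟨Φ.map_source hq, ?_, h.2⟩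
  rw [h.1]
  simpa using hq'

theorem jetLift_mem_transformDomain (hΦ : ContDiffOn ℝ ∞ Φ Φ.source)
    (hΨ : ContDiffOn ℝ ∞ Φ.symm Φ.target) {U : Set (Jet ι)} {q : Jet ι} (hqU : q ∈ U)
    (hq : toBase q ∈ Φ.source) (hq' : (totalDeriv Φ q).1 ≠ 0) :
    jetLift Φ q ∈ transformDomain Φ U := by
  obtain ⟨h1, h2, h3⟩ := jetLift_symm_jetLift hΦ hΨ hq hq'
  exact ⟨h1, h2, h3.symm ▸ hqU⟩

theorem exists_jetLift_eq (hΦ : ContDiffOn ℝ ∞ Φ Φ.source)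
    (hΨ : ContDiffOn ℝ ∞ Φ.symm Φ.target) {U : Set (Jet ι)} {q : Jet κ}
    (hq : q ∈ transformDomain Φ U) : ∃ x ∈ U, toBase x ∈ Φ.source ∧ (totalDeriv Φ x).1 ≠ 0 ∧
      jetLift Φ x = q ∧ jetLift Φ.symm q = x := by
  obtain ⟨h1, h2, h3⟩ := jetLift_symm_jetLift (Φ := Φ.symm) hΨ hΦ hq.1 hq.2.1
  exact ⟨_, hq.2.2, h1, h2, h3, rfl⟩

theorem contDiffOn_transformRHS (hΦ : ContDiffOn ℝ ∞ Φ Φ.source)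
    (hΨ : ContDiffOn ℝ ∞ Φ.symm Φ.target) {U : Set (Jet ι)} (hU : IsOpen U)
    {w : Jet ι → ι → ℝ} (hw : ContDiffOn ℝ ∞ w U) :
    ContDiffOn ℝ ∞ (transformRHS Φ w) (transformDomain Φ U) := by
  intro q hq
  obtain ⟨x, hxU, hx1, hx2, -, hx⟩ := exists_jetLift_eq hΦ hΨ hq
  have hg : ContDiffAt ℝ ∞ (jetLift Φ.symm) q := (hΨ.contDiffAt_target hq.1).jetLift hq.2.1
  have hΦx := hΦ.contDiffAt_source hx1
  have h1 : ContDiffAt ℝ ∞ (fun x => (totalDeriv Φ x).1⁻¹ •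
      (fderiv ℝ (jetLift Φ) x (odeOperator w x)).2.2) x :=
    (hΦx.totalDeriv.fst.inv hx2).smul
      (((hΦx.jetLift hx2).fderiv_right (m := ∞) (by simp)).clm_apply
        (contDiffAt_const.prodMk ((velocityL ι).contDiff.contDiffAt.prodMk
          (hw.contDiffAt (hU.mem_nhds hxU))))).snd.snd
  rw [← hx] at h1
  exact (ContDiffAt.comp q h1 hg).contDiffWithinAt

/-- Passing from the parameter $x$ to $t$ rescales the operator by $(dt/dx)^{-1}$, which is how
`transformRHS` was chosen. -/
theorem odeOperator_jetLift (hΦ : ContDiffOn ℝ ∞ Φ Φ.source)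
    (hΨ : ContDiffOn ℝ ∞ Φ.symm Φ.target) (w : Jet ι → ι → ℝ) {q : Jet ι}
    (hq : toBase q ∈ Φ.source) (hq' : (totalDeriv Φ q).1 ≠ 0) :
    odeOperator (transformRHS Φ w) (jetLift Φ q) =
      (totalDeriv Φ q).1⁻¹ • fderiv ℝ (jetLift Φ) q (odeOperator w q) := by
  have h := fderiv_jetLift (hΦ.contDiffAt_source hq) hq' (odeOperator w q)
  have hV : fderiv ℝ Φ (toBase q) (toBase (odeOperator w q)) = totalDeriv Φ q := rfl
  rw [odeOperator, transformRHS, (jetLift_symm_jetLift hΦ hΨ hq hq').2.2]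
  refine Prod.ext ?_ (Prod.ext ?_ rfl)
  · rw [h, hV]
    simp [hq']
  · rw [h, hV]
    rfl

theorem prolong_transformField (hΦ : ContDiffOn ℝ ∞ Φ Φ.source)
    (hΨ : ContDiffOn ℝ ∞ Φ.symm Φ.target) {Z : Base ι → Base ι} (hZ : ContDiffOn ℝ ∞ Z Φ.source)
    {q : Jet ι} (hq : toBase q ∈ Φ.source) (hq' : (totalDeriv Φ q).1 ≠ 0) :
    prolong (transformField Φ Z) (jetLift Φ q) = fderiv ℝ (jetLift Φ) q (prolong Z q) :=
  prolong_jetLift (hΦ.contDiffAt_source hq) hq'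
    ((hZ.contDiffAt (Φ.open_source.mem_nhds hq)).differentiableAt (by simp))
    (((contDiffOn_transformField hΦ hΨ hZ).contDiffAt
      (Φ.open_target.mem_nhds (Φ.map_source hq))).differentiableAt (by simp))
    (eventually_transformField hq)

theorem ContDiffAt.odeOperator {w : Jet ι → ι → ℝ} {q : Jet ι} (hw : ContDiffAt ℝ ∞ w q) :
    ContDiffAt ℝ ∞ (odeOperator w) q :=
  contDiffAt_const.prodMk ((velocityL ι).contDiff.contDiffAt.prodMk hw)

theorem fderiv_odeOperator {w : Jet ι → ι → ℝ} {q : Jet ι} (hw : DifferentiableAt ℝ w q)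
    (v : Jet ι) : fderiv ℝ (odeOperator w) q v = (0, v.2.2, fderiv ℝ w q v) := by
  have h : HasFDerivAt (odeOperator w) _ q :=
    (hasFDerivAt_const (1 : ℝ) q).prodMk ((velocityL ι).hasFDerivAt.prodMk hw.hasFDerivAt)
  rw [h.fderiv]
  rfl

/-- A field which commutes with the operator up to a factor is a symmetry: the factor is
determined by the component along the independent variable. -/
theorem lieBracket_odeOperator_of_smul {w : Jet ι → ι → ℝ} {Z : Base ι → Base ι} {q : Jet ι}
    (hw : DifferentiableAt ℝ w q) (hZ : ContDiffAt ℝ ∞ Z (toBase q)) {c : ℝ}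
    (h : lieBracket ℝ (prolong Z) (odeOperator w) q = c • odeOperator w q) :
    lieBracket ℝ (prolong Z) (odeOperator w) q =
      -(fderiv ℝ (fun q : Jet ι => (Z (toBase q)).1) q (odeOperator w q)) • odeOperator w q := by
  rw [h]
  congr 1
  have h1 := congrArg Prod.fst h
  have h2 : fderiv ℝ (fun q : Jet ι => (Z (toBase q)).1) q (odeOperator w q) =
      (fderiv ℝ Z (toBase q) (toBase (odeOperator w q))).1 := by
    have : HasFDerivAt (fun q : Jet ι => (Z (toBase q)).1) _ q :=
      ((hZ.differentiableAt (by simp)).hasFDerivAt.comp q (hasFDerivAt_toBase q)).fst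
    rw [this.fderiv]
    rfl
  rw [lieBracket_apply, fderiv_odeOperator hw, fderiv_prolong hZ] at h1
  rw [h2]
  simpa [ODESymmetry.odeOperator] using h1.symm

/-- The lifted map relates $Z^{(1)}$ to the new prolongation and $(dt/dx)^{-1}\mathbf A$ to the new
operator. Rescaling $\mathbf A$ keeps the bracket proportional to it, and the factor is then forced
by `lieBracket_odeOperator_of_smul`. -/
theorem isPointSymmetry_transform (hΦ : ContDiffOn ℝ ∞ Φ Φ.source)
    (hΨ : ContDiffOn ℝ ∞ Φ.symm Φ.target) {U : Set (Jet ι)} (hU : IsOpen U)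
    {w : Jet ι → ι → ℝ} (hw : ContDiffOn ℝ ∞ w U) {Z : Base ι → Base ι}
    (hZ : ContDiffOn ℝ ∞ Z Φ.source) (hsymm : IsPointSymmetry w U Z) :
    IsPointSymmetry (transformRHS Φ w) (transformDomain Φ U) (transformField Φ Z) := by
  intro q hq
  have hwq := (contDiffOn_transformRHS hΦ hΨ hU hw).contDiffAt
    ((isOpen_transformDomain hΨ hU).mem_nhds hq)
  have hXq := (contDiffOn_transformField hΦ hΨ hZ).contDiffAt (Φ.open_target.mem_nhds hq.1)
  obtain ⟨x, hxU, hx1, hx2, rfl, -⟩ := exists_jetLift_eq hΦ hΨ hq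
  have hΦx := hΦ.contDiffAt_source hx1
  have hZx := (hZ.contDiffAt (Φ.open_source.mem_nhds hx1)).prolong.differentiableAt (by simp)
  have hAx := (hw.contDiffAt (hU.mem_nhds hxU)).odeOperator.differentiableAt (by simp)
  have hF : DifferentiableAt ℝ (fun y => (totalDeriv Φ y).1⁻¹) x :=
    (hΦx.totalDeriv.fst.inv hx2).differentiableAt (by simp)
  have hnear := (isOpen_jetDomain hΦ isOpen_univ).mem_nhds
    (⟨hx1, hx2, mem_univ _⟩ : x ∈ {q | _ ∧ _ ∧ jetLift Φ q ∈ univ})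
  have hrel := lieBracket_of_related (f := jetLift Φ) (x := x) (V := prolong Z)
    (W := fun y => (totalDeriv Φ y).1⁻¹ • odeOperator w y)
    (V' := prolong (transformField Φ Z)) (W' := odeOperator (transformRHS Φ w))
    (contDiffAt_infty.1 (hΦx.jetLift hx2) 2) hZx (hF.smul hAx)
    (hXq.prolong.differentiableAt (by simp)) (hwq.odeOperator.differentiableAt (by simp))
    (by filter_upwards [hnear] with y hy using prolong_transformField hΦ hΨ hZ hy.1 hy.2.1)
    (by
      filter_upwards [hnear] with y hy
      rw [odeOperator_jetLift hΦ hΨ w hy.1 hy.2.1, map_smul])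
  have hA : fderiv ℝ (jetLift Φ) x (odeOperator w x) =
      (totalDeriv Φ x).1 • odeOperator (transformRHS Φ w) (jetLift Φ x) := by
    rw [odeOperator_jetLift hΦ hΨ w hx1 hx2, smul_inv_smul₀ hx2]
  have hbr := lieBracket_smul_right (V := prolong Z) hF hAx
  rw [hsymm x hxU, smul_smul] at hbr
  change lieBracket ℝ (prolong Z) (fun y => (totalDeriv Φ y).1⁻¹ • odeOperator w y) x = _ at hbr
  rw [hbr, ← add_smul, map_smul, hA, smul_smul] at hrel
  exact lieBracket_odeOperator_of_smul (hwq.differentiableAt (by simp)) hXq hrel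

/-- Restricting to jets with $dt/dx\ne0$ loses no base point: if $dt(1,\dot y)$ vanished for an open
set of velocities, $dt$ would be zero, contradicting the invertibility of the chart. -/
theorem exists_toBase_eq_of_mem_target (hΦ : ContDiffOn ℝ ∞ Φ Φ.source)
    (hΨ : ContDiffOn ℝ ∞ Φ.symm Φ.target) {U : Set (Jet ι)} (hU : IsOpen U)
    (hsub : Φ.source ⊆ toBase '' U) {p : Base κ} (hp : p ∈ Φ.target) :
    ∃ q ∈ transformDomain Φ U, toBase q = p := by
  have hp' := Φ.map_target hp
  obtain ⟨x, hxU, hx⟩ := hsub hp'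
  have hxs : toBase x ∈ Φ.source := hx ▸ hp'
  suffices h : ∃ y ∈ U, toBase y = toBase x ∧ (totalDeriv Φ y).1 ≠ 0 by
    obtain ⟨y, hyU, hy, hy'⟩ := h
    refine ⟨jetLift Φ y, jetLift_mem_transformDomain hΦ hΨ hyU (hy ▸ hxs) hy', ?_⟩
    rw [toBase_jetLift, hy, hx, Φ.right_inv hp]
  by_contra! hcon
  have h0 : (fderiv ℝ Φ (toBase x) (1, x.2.2)).1 = 0 := hcon x hxU rfl
  have hv : ∀ v : ι → ℝ, (fderiv ℝ Φ (toBase x) (0, v)).1 = 0 := by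
    intro v
    have hc : Continuous fun t : ℝ => ((x.1, x.2.1, x.2.2 + t • v) : Jet ι) := by fun_prop
    have hev : ∀ᶠ t : ℝ in 𝓝 0, ((x.1, x.2.1, x.2.2 + t • v) : Jet ι) ∈ U :=
      hc.continuousAt.eventually_mem (hU.mem_nhds (by simpa using hxU))
    obtain ⟨t, ht, ht0⟩ := ((hev.filter_mono nhdsWithin_le_nhds).and
      (self_mem_nhdsWithin (s := {(0 : ℝ)}ᶜ))).exists
    have h1 := hcon _ ht rfl
    have h2 : ((1, x.2.2 + t • v) : Base ι) = (1, x.2.2) + t • (0, v) := by ext <;> simp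
    rw [totalDeriv] at h1
    change (fderiv ℝ Φ (toBase x) (1, x.2.2 + t • v)).1 = 0 at h1
    rw [h2, map_add, map_smul, Prod.fst_add, h0, zero_add, Prod.smul_fst] at h1
    exact (smul_eq_zero.1 h1).resolve_left ht0
  have hall : ∀ u : Base ι, (fderiv ℝ Φ (toBase x) u).1 = 0 := by
    intro u
    have h2 : u = u.1 • (1, x.2.2) + (0, u.2 - u.1 • x.2.2) := by ext <;> simp
    rw [h2, map_add, map_smul, Prod.fst_add, Prod.smul_fst, h0, hv]
    simp
  have h3 := fderiv_symm_fderiv (Φ := Φ.symm) hΨ hΦ (p := Φ (toBase x)) (Φ.map_source hxs) (1, 0)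
  rw [OpenPartialHomeomorph.symm_symm, Φ.left_inv hxs] at h3
  have h4 := hall (fderiv ℝ Φ.symm (Φ (toBase x)) (1, 0))
  rw [h3] at h4
  exact one_ne_zero h4

theorem fderiv_jetLift_injective (hΦ : ContDiffOn ℝ ∞ Φ Φ.source)
    (hΨ : ContDiffOn ℝ ∞ Φ.symm Φ.target) {q : Jet ι} (hq : toBase q ∈ Φ.source)
    (hq' : (totalDeriv Φ q).1 ≠ 0) : Function.Injective (fderiv ℝ (jetLift Φ) q) := by
  obtain ⟨h1, h2, h3⟩ := jetLift_symm_jetLift hΦ hΨ hq hq'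
  have hd := (((hΦ.contDiffAt_source hq).jetLift hq').differentiableAt (by simp)).hasFDerivAt
  have hd' := (((hΨ.contDiffAt_target h1).jetLift h2).differentiableAt (by simp)).hasFDerivAt
  have hnear := (isOpen_jetDomain hΦ isOpen_univ).mem_nhds
    (⟨hq, hq', mem_univ _⟩ : q ∈ {q | _ ∧ _ ∧ jetLift Φ q ∈ univ})
  have hid := (hd'.comp q hd).unique ((hasFDerivAt_id q).congr_of_eventuallyEq (by
    filter_upwards [hnear] with y hy using (jetLift_symm_jetLift hΦ hΨ hy.1 hy.2.1).2.2))
  exact Function.LeftInverse.injective fun v => DFunLike.congr_fun hid v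

end Transport

/-! ### Inherited symmetries in straightened coordinates. -/

section Straightened

variable {m n k : ℕ}

/-- The vector `∂_{s^i}` in the space of the variables `(t, s)`. -/
def baseDir (m n : ℕ) (i : Fin m) : Base (Fin m ⊕ Fin n) := (0, Pi.single (Sum.inl i) 1)

/-- The vector `∂_{s^i}` in the space of the jets `(t, s, ṡ)`. -/
def jetDir (m n : ℕ) (i : Fin m) : Jet (Fin m ⊕ Fin n) := (0, Pi.single (Sum.inl i) 1, 0)

theorem toReducedBaseL_baseDir (i : Fin m) : toReducedBaseL m n (baseDir m n i) = 0 :=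
  Prod.ext rfl (funext fun β => by simp [toReducedBaseL, baseDir])

theorem eq_sum_baseDir {b : Base (Fin m ⊕ Fin n)} (hb : toReducedBaseL m n b = 0) :
    b = ∑ i, b.2 (Sum.inl i) • baseDir m n i := by
  refine ext_abelianPart (funext fun j => ?_) ?_
  · rw [map_sum]
    simp [abelianPartL_apply, baseDir, Pi.single_apply]
  · simp [hb, toReducedBaseL_baseDir]

/-- `dropS` on tangent vectors, as a continuous linear map. -/
def dropSL (m n : ℕ) : Jet (Fin m ⊕ Fin n) →L[ℝ] Jet (Fin m ⊕ Fin n) :=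
  ContinuousLinearMap.id ℝ _ - ∑ i : Fin m,
    (((ContinuousLinearMap.proj (R := ℝ) (φ := fun _ : Fin m ⊕ Fin n => ℝ) (Sum.inl i)).comp
      ((ContinuousLinearMap.snd ℝ _ _).comp (toBaseL _))).smulRight (jetDir m n i))

theorem dropSL_apply (q : Jet (Fin m ⊕ Fin n)) :
    dropSL m n q = q - ∑ i, q.2.1 (Sum.inl i) • jetDir m n i := by
  simp [dropSL, sum_apply, toBaseL]

theorem dropS_eq (X : Jet (Fin m ⊕ Fin n) → Jet (Fin m ⊕ Fin n)) (q : Jet (Fin m ⊕ Fin n)) :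
    dropS X q = dropSL m n (X q) := by
  rw [dropSL_apply, dropS]
  refine Prod.ext ?_ (Prod.ext (funext fun μ => ?_) ?_)
  · simp [Prod.fst_sum, jetDir]
  · rcases μ with i | β <;>
      simp [Prod.fst_sum, Prod.snd_sum, jetDir, Finset.sum_apply, Pi.single_apply]
  · simp [Prod.snd_sum, jetDir]

theorem dropSL_jetDir (i : Fin m) : dropSL m n (jetDir m n i) = 0 := by
  rw [dropSL_apply]
  simp [jetDir, Pi.single_apply]

/-- `toReduced` as a continuous linear map. -/
def toReducedL (m n : ℕ) : Jet (Fin m ⊕ Fin n) →L[ℝ] Reduced m n :=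
  (ContinuousLinearMap.fst ℝ _ _).prod (((ContinuousLinearMap.snd ℝ _ _).comp
    ((toReducedBaseL m n).comp (toBaseL _))).prod
      ((ContinuousLinearMap.pi fun i => (ContinuousLinearMap.proj (R := ℝ)
        (φ := fun _ : Fin m ⊕ Fin n => ℝ) (Sum.inl i)).comp (velocityL _)).prod
      (ContinuousLinearMap.pi fun β => (ContinuousLinearMap.proj (R := ℝ)
        (φ := fun _ : Fin m ⊕ Fin n => ℝ) (Sum.inr β)).comp (velocityL _))))

theorem toReducedL_apply (q : Jet (Fin m ⊕ Fin n)) : toReducedL m n q = toReduced q := rfl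

theorem toReducedL_jetDir (i : Fin m) : toReducedL m n (jetDir m n i) = 0 := by
  refine Prod.ext rfl (Prod.ext (funext fun β => ?_) rfl)
  simp [toReducedL, toReducedBaseL, toBaseL, jetDir]

theorem eq_sum_jetDir {v : Jet (Fin m ⊕ Fin n)} (hv : toReducedL m n v = 0) :
    v = ∑ i, v.2.1 (Sum.inl i) • jetDir m n i := by
  have h1 : v.1 = 0 := congrArg (fun r => r.1) hv
  have h2 : ∀ β, v.2.1 (Sum.inr β) = 0 := fun β => congrFun (congrArg (fun r => r.2.1) hv) β
  have h3 : ∀ i, v.2.2 (Sum.inl i) = 0 := fun β => congrFun (congrArg (fun r => r.2.2.1) hv) β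
  have h4 : ∀ β, v.2.2 (Sum.inr β) = 0 := fun β => congrFun (congrArg (fun r => r.2.2.2) hv) β
  refine Prod.ext ?_ (Prod.ext (funext fun μ => ?_) (funext fun μ => ?_))
  · simp [Prod.fst_sum, jetDir, h1]
  · rcases μ with i | β <;>
      simp [Prod.fst_sum, Prod.snd_sum, jetDir, Finset.sum_apply, Pi.single_apply, h2]
  · rcases μ with i | β <;>
      simp [Prod.snd_sum, jetDir, Finset.sum_apply, h3, h4]

/-- The condition `[Y, Â] = -Â(ξ) Â` in straightened coordinates. -/
def IsReducedSymmetry (w : Jet (Fin m ⊕ Fin n) → Fin m ⊕ Fin n → ℝ)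
    (U : Set (Jet (Fin m ⊕ Fin n))) (Y : Base (Fin m ⊕ Fin n) → Base (Fin m ⊕ Fin n)) : Prop :=
  ∀ q ∈ U, lieBracket ℝ (dropS (prolong Y)) (dropS (odeOperator w)) q =
    -(fderiv ℝ (fun q : Jet (Fin m ⊕ Fin n) => (Y (toBase q)).1) q (dropS (odeOperator w) q)) •
      dropS (odeOperator w) q

/-- A system of differential equations with symmetries `X M`, in coordinates in which
`X (inl i) = ∂_{s^i}`. -/
structure IsStraightened (U : Set (Jet (Fin m ⊕ Fin n)))
    (w : Jet (Fin m ⊕ Fin n) → Fin m ⊕ Fin n → ℝ)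
    (X : Fin m ⊕ Fin k → Base (Fin m ⊕ Fin n) → Base (Fin m ⊕ Fin n))
    (C : Fin m ⊕ Fin k → Fin m ⊕ Fin k → Fin m ⊕ Fin k → ℝ) : Prop where
  isOpen : IsOpen U
  nonempty : U.Nonempty
  contDiffOn_rhs : ContDiffOn ℝ ∞ w U
  contDiffOn_field : ∀ M, ContDiffOn ℝ ∞ (X M) (toBase '' U)
  straight : ∀ i, ∀ p ∈ toBase '' U, X (Sum.inl i) p = baseDir m n i
  symm : ∀ M, IsPointSymmetry w U (X M)
  bracket : ∀ M N, ∀ p ∈ toBase '' U, lieBracket ℝ (X M) (X N) p = ∑ L, C M N L • X L p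
  indep : ∀ W, IsOpen W → W.Nonempty → W ⊆ toBase '' U → ∀ c : Fin m ⊕ Fin k → ℝ,
    (∀ p ∈ W, ∑ M, c M • X M p = 0) → ∀ M, c M = 0
  operator_indep : n = 0 → ∀ W, IsOpen W → W.Nonempty → W ⊆ U → ∃ q ∈ W,
    odeOperator w q ∉ Submodule.span ℝ (range fun M => prolong (X M) q)

namespace IsStraightened

variable {U : Set (Jet (Fin m ⊕ Fin n))} {w : Jet (Fin m ⊕ Fin n) → Fin m ⊕ Fin n → ℝ}
  {X : Fin m ⊕ Fin k → Base (Fin m ⊕ Fin n) → Base (Fin m ⊕ Fin n)}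
  {C : Fin m ⊕ Fin k → Fin m ⊕ Fin k → Fin m ⊕ Fin k → ℝ}

theorem isOpen_base (S : IsStraightened U w X C) : IsOpen (toBase '' U) :=
  isOpenMap_toBase _ S.isOpen

theorem contDiffAt_field (S : IsStraightened U w X C) (M : Fin m ⊕ Fin k)
    {p : Base (Fin m ⊕ Fin n)} (hp : p ∈ toBase '' U) : ContDiffAt ℝ ∞ (X M) p :=
  (S.contDiffOn_field M).contDiffAt (S.isOpen_base.mem_nhds hp)

theorem contDiffAt_rhs (S : IsStraightened U w X C) {q : Jet (Fin m ⊕ Fin n)} (hq : q ∈ U) :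
    ContDiffAt ℝ ∞ w q :=
  S.contDiffOn_rhs.contDiffAt (S.isOpen.mem_nhds hq)

theorem straight_eventuallyEq (S : IsStraightened U w X C) (i : Fin m)
    {p : Base (Fin m ⊕ Fin n)} (hp : p ∈ toBase '' U) :
    X (Sum.inl i) =ᶠ[𝓝 p] fun _ => baseDir m n i := by
  filter_upwards [S.isOpen_base.mem_nhds hp] with p' hp' using S.straight i p' hp'

theorem prolong_straight (S : IsStraightened U w X C) (i : Fin m) {q : Jet (Fin m ⊕ Fin n)}
    (hq : q ∈ U) : prolong (X (Sum.inl i)) q = jetDir m n i := by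
  rw [(S.straight_eventuallyEq i (mem_image_of_mem _ hq)).prolong_eq, prolong_const]
  rfl

theorem lieBracket_straight (S : IsStraightened U w X C) (i : Fin m)
    (Y : Base (Fin m ⊕ Fin n) → Base (Fin m ⊕ Fin n)) {p : Base (Fin m ⊕ Fin n)}
    (hp : p ∈ toBase '' U) :
    lieBracket ℝ (X (Sum.inl i)) Y p = fderiv ℝ Y p (baseDir m n i) := by
  rw [lieBracket_apply, (S.straight_eventuallyEq i hp).fderiv_eq, S.straight i p hp]
  simp

theorem lieBracket_prolong_straight (S : IsStraightened U w X C) (i : Fin m)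
    (Y : Jet (Fin m ⊕ Fin n) → Jet (Fin m ⊕ Fin n)) {q : Jet (Fin m ⊕ Fin n)} (hq : q ∈ U) :
    lieBracket ℝ (prolong (X (Sum.inl i))) Y q = fderiv ℝ Y q (jetDir m n i) := by
  have h : prolong (X (Sum.inl i)) =ᶠ[𝓝 q] fun _ => jetDir m n i := by
    filter_upwards [S.isOpen.mem_nhds hq] with q' hq' using S.prolong_straight i hq'
  rw [lieBracket_apply, h.fderiv_eq, S.prolong_straight i hq]
  simp

/-- For $\partial_{s^i}$ the component ξ is zero, so the symmetry condition is plain commutation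
with the operator. -/
theorem fderiv_odeOperator_jetDir (S : IsStraightened U w X C) (i : Fin m)
    {q : Jet (Fin m ⊕ Fin n)} (hq : q ∈ U) : fderiv ℝ (odeOperator w) q (jetDir m n i) = 0 := by
  have h : (fun q : Jet (Fin m ⊕ Fin n) => (X (Sum.inl i) (toBase q)).1) =ᶠ[𝓝 q]
      fun _ => 0 := by
    filter_upwards [S.isOpen.mem_nhds hq] with q' hq'
    rw [S.straight i _ (mem_image_of_mem _ hq')]
    rfl
  rw [← S.lieBracket_prolong_straight i _ hq, S.symm _ q hq, h.fderiv_eq]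
  simp

theorem fderiv_rhs_jetDir (S : IsStraightened U w X C) (i : Fin m)
    {q : Jet (Fin m ⊕ Fin n)} (hq : q ∈ U) : fderiv ℝ w q (jetDir m n i) = 0 := by
  have h := S.fderiv_odeOperator_jetDir i hq
  rw [fderiv_odeOperator ((S.contDiffAt_rhs hq).differentiableAt (by simp))] at h
  exact congrArg (fun x => x.2.2) h

/-- Both derivatives are brackets with $\partial_{s^j}$ and its prolongation, and prolongation
preserves brackets. -/
theorem fderiv_prolong_jetDir (S : IsStraightened U w X C)
    {Y : Base (Fin m ⊕ Fin n) → Base (Fin m ⊕ Fin n)} (j : Fin m) {q : Jet (Fin m ⊕ Fin n)}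
    (hq : q ∈ U) (hY : ContDiffAt ℝ ∞ Y (toBase q)) :
    fderiv ℝ (prolong Y) q (jetDir m n j) =
      prolong (fun p => fderiv ℝ Y p (baseDir m n j)) q := by
  rw [← S.lieBracket_prolong_straight j _ hq,
    lieBracket_prolong (S.contDiffAt_field _ (mem_image_of_mem _ hq)) hY]
  refine Filter.EventuallyEq.prolong_eq ?_
  filter_upwards [S.isOpen_base.mem_nhds (mem_image_of_mem _ hq)] with p hp
    using S.lieBracket_straight j Y hp

/-- `[Y, Â] = -Â(ξ) Â` in terms of the derivatives along the `∂_{s^j}`. -/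
theorem isReducedSymmetry_iff (S : IsStraightened U w X C)
    {Y : Base (Fin m ⊕ Fin n) → Base (Fin m ⊕ Fin n)} (hY : ContDiffOn ℝ ∞ Y (toBase '' U))
    (hsymm : IsPointSymmetry w U Y) :
    IsReducedSymmetry w U Y ↔ ∀ q ∈ U, ∑ j, q.2.2 (Sum.inl j) •
      dropSL m n (prolong (fun p => fderiv ℝ Y p (baseDir m n j)) q -
        (fderiv ℝ Y (toBase q) (baseDir m n j)).1 • odeOperator w q) = 0 := by
  refine forall₂_congr fun q hq => ?_
  have hYq : ContDiffAt ℝ ∞ Y (toBase q) :=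
    hY.contDiffAt (S.isOpen_base.mem_nhds (mem_image_of_mem _ hq))
  have hV := (hYq.prolong.differentiableAt (by simp)).hasFDerivAt
  have hA := ((S.contDiffAt_rhs hq).odeOperator.differentiableAt (by simp)).hasFDerivAt
  have hV' : HasFDerivAt (dropS (prolong Y)) ((dropSL m n).comp (fderiv ℝ (prolong Y) q)) q :=
    ((dropSL m n).hasFDerivAt.comp q hV).congr_of_eventuallyEq
      (Eventually.of_forall (dropS_eq _))
  have hA' : HasFDerivAt (dropS (odeOperator w))
      ((dropSL m n).comp (fderiv ℝ (odeOperator w) q)) q :=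
    ((dropSL m n).hasFDerivAt.comp q hA).congr_of_eventuallyEq
      (Eventually.of_forall (dropS_eq _))
  have hξ : HasFDerivAt (fun q : Jet (Fin m ⊕ Fin n) => (Y (toBase q)).1)
      ((ContinuousLinearMap.fst ℝ _ _).comp ((fderiv ℝ Y (toBase q)).comp (toBaseL _))) q :=
    ((hYq.differentiableAt (by simp)).hasFDerivAt.comp q (hasFDerivAt_toBase q)).fst
  have hs := hsymm q hq
  rw [hξ.fderiv] at hs ⊢
  set ξ' := (ContinuousLinearMap.fst ℝ ℝ (Fin m ⊕ Fin n → ℝ)).comp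
    ((fderiv ℝ Y (toBase q)).comp (toBaseL _)) with hξ'
  -- Dropping components of the argument is harmless for the derivative of the operator; for the
  -- derivatives of $Y^{(1)}$ and ξ it costs the terms $\dot s^j\partial_{s^j}$ in `h2` and `h3`.
  have h1 : fderiv ℝ (odeOperator w) q (dropSL m n (prolong Y q)) =
      fderiv ℝ (odeOperator w) q (prolong Y q) := by
    rw [dropSL_apply, map_sub, map_sum]
    simp [S.fderiv_odeOperator_jetDir _ hq]
  have hdrop : dropSL m n (odeOperator w q) =
      odeOperator w q - ∑ j, q.2.2 (Sum.inl j) • jetDir m n j := dropSL_apply _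
  have h2 : fderiv ℝ (prolong Y) q (dropSL m n (odeOperator w q)) =
      fderiv ℝ (prolong Y) q (odeOperator w q) -
        ∑ j, q.2.2 (Sum.inl j) • prolong (fun p => fderiv ℝ Y p (baseDir m n j)) q := by
    rw [hdrop, map_sub, map_sum]
    simp only [map_smul, S.fderiv_prolong_jetDir _ hq hYq]
  have h3 : ξ' (dropSL m n (odeOperator w q)) = ξ' (odeOperator w q) -
      ∑ j, q.2.2 (Sum.inl j) * (fderiv ℝ Y (toBase q) (baseDir m n j)).1 := by
    rw [hdrop, map_sub, map_sum]
    simp only [map_smul, smul_eq_mul]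
    rfl
  have h4 : lieBracket ℝ (dropS (prolong Y)) (dropS (odeOperator w)) q =
      dropSL m n (lieBracket ℝ (prolong Y) (odeOperator w) q) +
        ∑ j, q.2.2 (Sum.inl j) •
          dropSL m n (prolong (fun p => fderiv ℝ Y p (baseDir m n j)) q) := by
    rw [lieBracket_apply, lieBracket_apply, hV'.fderiv, hA'.fderiv, dropS_eq, dropS_eq,
      ContinuousLinearMap.comp_apply, ContinuousLinearMap.comp_apply, h1, h2]
    simp only [map_sub, map_sum, map_smul]
    abel
  rw [h4, hs, dropS_eq, h3, ← sub_eq_zero]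
  have h5 : ∑ j, q.2.2 (Sum.inl j) • dropSL m n
      (prolong (fun p => fderiv ℝ Y p (baseDir m n j)) q -
        (fderiv ℝ Y (toBase q) (baseDir m n j)).1 • odeOperator w q) =
      ∑ j, q.2.2 (Sum.inl j) • dropSL m n (prolong (fun p => fderiv ℝ Y p (baseDir m n j)) q) -
      (∑ j, q.2.2 (Sum.inl j) * (fderiv ℝ Y (toBase q) (baseDir m n j)).1) •
        dropSL m n (odeOperator w q) := by
    simp only [map_sub, map_smul, smul_sub, Finset.sum_sub_distrib, Finset.sum_smul, smul_smul]
  rw [h5, map_smul]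
  refine Eq.congr_left ?_
  module

theorem eventually_mem_fibre (S : IsStraightened U w X C) {q : Jet (Fin m ⊕ Fin n)} (hq : q ∈ U) :
    ∀ᶠ u in 𝓝 q.2.2, ((q.1, q.2.1, u) : Jet (Fin m ⊕ Fin n)) ∈ U := by
  have hc : Continuous fun u => ((q.1, q.2.1, u) : Jet (Fin m ⊕ Fin n)) := by fun_prop
  exact hc.continuousAt.eventually_mem (S.isOpen.mem_nhds hq)

theorem contDiffAt_fderiv_baseDir (S : IsStraightened U w X C) (M : Fin m ⊕ Fin k) (j : Fin m)
    {p : Base (Fin m ⊕ Fin n)} (hp : p ∈ toBase '' U) :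
    ContDiffAt ℝ ∞ (fun p => fderiv ℝ (X M) p (baseDir m n j)) p :=
  ((S.contDiffAt_field M hp).fderiv_right (m := ∞) (by simp)).clm_apply contDiffAt_const

theorem fderiv_fderiv_baseDir (S : IsStraightened U w X C) (M : Fin m ⊕ Fin k) (j : Fin m)
    {p : Base (Fin m ⊕ Fin n)} (hp : p ∈ toBase '' U) (v : Base (Fin m ⊕ Fin n)) :
    fderiv ℝ (fun p => fderiv ℝ (X M) p (baseDir m n j)) p v =
      fderiv ℝ (fderiv ℝ (X M)) p v (baseDir m n j) := by
  have h := (((S.contDiffAt_field M hp).fderiv_right (m := ∞) (by simp)).differentiableAt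
    (by simp)).hasFDerivAt.clm_apply (hasFDerivAt_const (baseDir m n j) p)
  rw [h.fderiv]
  simp

theorem fderiv_field_baseDir (S : IsStraightened U w X C) (M : Fin m ⊕ Fin k) (j : Fin m)
    {p : Base (Fin m ⊕ Fin n)} (hp : p ∈ toBase '' U) :
    fderiv ℝ (X M) p (baseDir m n j) = ∑ L, C (Sum.inl j) M L • X L p := by
  rw [← S.lieBracket_straight j (X M) hp, S.bracket _ _ p hp]

theorem prolong_fderiv_baseDir (S : IsStraightened U w X C) (M : Fin m ⊕ Fin k) (j : Fin m)
    {q : Jet (Fin m ⊕ Fin n)} (hq : q ∈ U) :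
    prolong (fun p => fderiv ℝ (X M) p (baseDir m n j)) q =
      ∑ L, C (Sum.inl j) M L • prolong (X L) q := by
  have hp := mem_image_of_mem toBase hq
  rw [← prolong_sum_smul _ fun L => (S.contDiffAt_field L hp).differentiableAt (by simp)]
  refine Filter.EventuallyEq.prolong_eq ?_
  filter_upwards [S.isOpen_base.mem_nhds hp] with p hp using S.fderiv_field_baseDir M j hp

theorem toReducedL_dropSL (v : Jet (Fin m ⊕ Fin n)) :
    toReducedL m n (dropSL m n v) = toReducedL m n v := by
  rw [dropSL_apply, map_sub, map_sum]
  simp [toReducedL_jetDir]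

theorem sub_dropSL_mem_span (S : IsStraightened U w X C) {q : Jet (Fin m ⊕ Fin n)} (hq : q ∈ U)
    (v : Jet (Fin m ⊕ Fin n)) :
    v - dropSL m n v ∈ Submodule.span ℝ (range fun M => prolong (X M) q) := by
  rw [dropSL_apply, sub_sub_cancel]
  refine Submodule.sum_mem _ fun i _ => Submodule.smul_mem _ _ ?_
  rw [← S.prolong_straight i hq]
  exact Submodule.subset_span ⟨_, rfl⟩

/-- If there are no variables `s^α`, the `∂_t` components of the derivatives of an inherited field
along the `∂_{s^j}` vanish, since the operator is linearly independent of the generators. -/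
theorem fderiv_baseDir_fst_of_operator_indep (S : IsStraightened U w X C) (hn : n = 0)
    {M : Fin m ⊕ Fin k} (hI : IsReducedSymmetry w U (X M)) (j : Fin m)
    {p : Base (Fin m ⊕ Fin n)} (hp : p ∈ toBase '' U) :
    (fderiv ℝ (X M) p (baseDir m n j)).1 = 0 := by
  rw [S.isReducedSymmetry_iff (S.contDiffOn_field M) (S.symm M)] at hI
  let f : Jet (Fin m ⊕ Fin n) → ℝ := fun q =>
    ∑ j, q.2.2 (Sum.inl j) * (fderiv ℝ (X M) (toBase q) (baseDir m n j)).1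
  have hf : ContinuousOn f U := by
    refine continuousOn_finsetSum _ fun j _ => ContinuousOn.mul (by fun_prop) fun q hq => ?_
    exact ((S.contDiffAt_fderiv_baseDir M j
      (mem_image_of_mem _ hq)).comp_toBase.fst).continuousAt.continuousWithinAt
  -- Where $f\ne0$, the reduced condition solves for $\hat{\mathbf A}$ as a combination of prolonged
  -- generators; adding back the $\partial_{s^i}$ puts $\mathbf A$ in their span on an open set.
  have hf0 : ∀ q ∈ U, f q = 0 := by
    by_contra! hne
    obtain ⟨q₀, hq₀, hfq₀⟩ := hne
    obtain ⟨q, ⟨hq, hfq⟩, hspan⟩ := S.operator_indep hn (U ∩ f ⁻¹' {0}ᶜ)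
      (hf.isOpen_inter_preimage S.isOpen isOpen_compl_singleton) ⟨q₀, hq₀, hfq₀⟩
      inter_subset_left
    set 𝒮 := Submodule.span ℝ (range fun M => prolong (X M) q)
    have hdrop : ∀ v ∈ 𝒮, dropSL m n v ∈ 𝒮 := fun v hv => by
      have := 𝒮.sub_mem hv (S.sub_dropSL_mem_span hq v)
      rwa [sub_sub_cancel] at this
    have hW : ∀ j, prolong (fun p => fderiv ℝ (X M) p (baseDir m n j)) q ∈ 𝒮 := fun j => by
      rw [S.prolong_fderiv_baseDir M j hq]
      exact Submodule.sum_mem _ fun L _ => Submodule.smul_mem _ _ (Submodule.subset_span ⟨L, rfl⟩)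
    have hsum : f q • dropSL m n (odeOperator w q) = ∑ j, q.2.2 (Sum.inl j) •
        dropSL m n (prolong (fun p => fderiv ℝ (X M) p (baseDir m n j)) q) := by
      have := hI q hq
      simp only [map_sub, map_smul, smul_sub, Finset.sum_sub_distrib, smul_smul] at this
      rw [sub_eq_zero] at this
      rw [this, Finset.sum_smul]
    have hmem : f q • dropSL m n (odeOperator w q) ∈ 𝒮 := by
      rw [hsum]
      exact Submodule.sum_mem _ fun j _ => Submodule.smul_mem _ _ (hdrop _ (hW j))
    have := 𝒮.add_mem (S.sub_dropSL_mem_span hq (odeOperator w q))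
      ((Submodule.smul_mem_iff _ hfq).1 hmem)
    rw [sub_add_cancel] at this
    exact hspan this
  obtain ⟨q, hq, rfl⟩ := hp
  have h := (linear_add_quadratic_eq_zero (v := q.2.2)
    (∑ j, (LinearMap.proj (R := ℝ) (φ := fun _ : Fin m ⊕ Fin n => ℝ) (Sum.inl j)).smulRight
      (fderiv ℝ (X M) (toBase q) (baseDir m n j)).1) 0 (by
      filter_upwards [S.eventually_mem_fibre hq] with u hu
      have := hf0 _ hu
      simpa [f, toBase] using this)).1 (Pi.single (Sum.inl j) 1)
  simpa [Pi.single_apply] using h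

/-- The derivatives of an inherited field along the `∂_{s^j}` are combinations of the
`∂_{s^i}`. -/
theorem toReducedBaseL_fderiv_baseDir (S : IsStraightened U w X C) {M : Fin m ⊕ Fin k}
    (hI : IsReducedSymmetry w U (X M)) (j : Fin m) {p : Base (Fin m ⊕ Fin n)}
    (hp : p ∈ toBase '' U) : toReducedBaseL m n (fderiv ℝ (X M) p (baseDir m n j)) = 0 := by
  have hI' := (S.isReducedSymmetry_iff (S.contDiffOn_field M) (S.symm M)).1 hI
  obtain ⟨q, hq, rfl⟩ := hp
  have hβ : ∀ β : Fin n, (fderiv ℝ (X M) (toBase q) (baseDir m n j)).1 = 0 ∧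
      (fderiv ℝ (X M) (toBase q) (baseDir m n j)).2 (Sum.inr β) = 0 := by
    intro β
    -- The $\partial_{s^\beta}$ component at a fixed base point: $\sum_j\dot s^j(W_j^\beta-W_j^t\dot
    -- s^\beta)$, a polynomial in the velocities.
    have h := linear_add_quadratic_eq_zero (v := q.2.2)
      (∑ j, (LinearMap.proj (R := ℝ) (φ := fun _ : Fin m ⊕ Fin n => ℝ) (Sum.inl j)).smulRight
        ((fderiv ℝ (X M) (toBase q) (baseDir m n j)).2 (Sum.inr β)))
      (∑ j, (LinearMap.proj (R := ℝ) (φ := fun _ : Fin m ⊕ Fin n => ℝ) (Sum.inl j)).smulRight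
        (-(fderiv ℝ (X M) (toBase q) (baseDir m n j)).1 •
          LinearMap.proj (R := ℝ) (φ := fun _ : Fin m ⊕ Fin n => ℝ) (Sum.inr β))) (by
        filter_upwards [S.eventually_mem_fibre hq] with u hu
        have h1 := congrArg (fun v => (toReducedL m n v).2.1 β) (hI' _ hu)
        simp only [map_sum, map_smul, toReducedL_dropSL] at h1
        have h2 : ∑ j, u (Sum.inl j) *
            ((fderiv ℝ (X M) (toBase q) (baseDir m n j)).2 (Sum.inr β) -
              (fderiv ℝ (X M) (toBase q) (baseDir m n j)).1 * u (Sum.inr β)) = 0 := by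
          refine Eq.trans ?_ h1
          simp only [Prod.snd_sum, Prod.fst_sum, Finset.sum_apply]
          rfl
        rw [← h2]
        simp only [sub_eq_add_neg, mul_add, Finset.sum_add_distrib]
        simp)
    refine ⟨?_, ?_⟩
    -- At this velocity the quadratic form takes the value $-W_j^t$.
    · have := h.2 (Pi.single (Sum.inl j) 1 + Pi.single (Sum.inr β) 1)
      simpa [Pi.single_apply, sum_apply] using this
    · have := h.1 (Pi.single (Sum.inl j) 1)
      simpa [Pi.single_apply, sum_apply] using this
  refine Prod.ext ?_ (funext fun β => (hβ β).2)
  rcases Nat.eq_zero_or_pos n with hn | hn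
  · exact S.fderiv_baseDir_fst_of_operator_indep hn hI j (mem_image_of_mem _ hq)
  · exact (hβ ⟨0, hn⟩).1

/-- The derivatives of an inherited field along the `∂_{s^j}` are locally constant. -/
theorem fderiv_fderiv_baseDir_eq_zero (S : IsStraightened U w X C) {M : Fin m ⊕ Fin k}
    (hI : IsReducedSymmetry w U (X M)) (j : Fin m) {p : Base (Fin m ⊕ Fin n)}
    (hp : p ∈ toBase '' U) :
    fderiv ℝ (fun p => fderiv ℝ (X M) p (baseDir m n j)) p = 0 := by
  have hI' := (S.isReducedSymmetry_iff (S.contDiffOn_field M) (S.symm M)).1 hI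
  obtain ⟨q, hq, rfl⟩ := hp
  set W : Fin m → Base (Fin m ⊕ Fin n) → Base (Fin m ⊕ Fin n) := fun j p =>
    fderiv ℝ (X M) p (baseDir m n j) with hW
  have hT := mem_image_of_mem toBase hq
  have hW1 : ∀ j, ∀ p ∈ toBase '' U, (W j p).1 = 0 := fun j p hp =>
    congrArg Prod.fst (S.toReducedBaseL_fderiv_baseDir hI j hp)
  have hDW1 : ∀ j v, (fderiv ℝ (W j) (toBase q) v).1 = 0 := by
    intro j v
    have h := ((S.contDiffAt_fderiv_baseDir M j hT).differentiableAt (by simp)).hasFDerivAt.fst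
    have h0 : HasFDerivAt (fun p => (W j p).1) (0 : _ →L[ℝ] ℝ) (toBase q) := by
      refine (hasFDerivAt_const (0 : ℝ) _).congr_of_eventuallyEq ?_
      filter_upwards [S.isOpen_base.mem_nhds hT] with p hp using hW1 j p hp
    exact DFunLike.congr_fun (h.unique h0) v
  -- Since $W_j^t=0$, the unknown right-hand side `w` drops out and the velocity components become
  -- $\sum_j\dot s^j\,dW_j(1,\dot s)$.
  have hquad := linear_add_quadratic_eq_zero (v := q.2.2)
    (∑ j, (LinearMap.proj (R := ℝ) (φ := fun _ : Fin m ⊕ Fin n => ℝ) (Sum.inl j)).smulRight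
      (fderiv ℝ (W j) (toBase q) (1, 0)))
    (∑ j, (LinearMap.proj (R := ℝ) (φ := fun _ : Fin m ⊕ Fin n => ℝ) (Sum.inl j)).smulRight
      ((fderiv ℝ (W j) (toBase q)).toLinearMap.comp (LinearMap.inr ℝ ℝ (Fin m ⊕ Fin n → ℝ)))) (by
      filter_upwards [S.eventually_mem_fibre hq] with u hu
      have h1 := congrArg (toReducedL m n) (hI' _ hu)
      simp only [map_sum, map_smul, toReducedL_dropSL, map_zero] at h1
      have h2 : ∀ j, prolong (W j) (q.1, q.2.1, u) -
          (W j (toBase (q.1, q.2.1, u))).1 • odeOperator w (q.1, q.2.1, u) =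
          ((W j (toBase q)).1, (W j (toBase q)).2, (fderiv ℝ (W j) (toBase q) (1, u)).2) := by
        intro j
        have h3 : (totalDeriv (W j) (q.1, q.2.1, u)).1 = 0 := hDW1 j _
        have h4 : (W j (toBase (q.1, q.2.1, u))).1 = 0 := hW1 j _ hT
        rw [prolong, h3, h4, zero_smul, zero_smul, sub_zero, sub_zero]
        exact Prod.ext h4.symm rfl
      have h5 : ∑ j, u (Sum.inl j) • fderiv ℝ (W j) (toBase q) (1, u) = 0 := by
        refine Prod.ext ?_ (funext fun μ => ?_)
        · simp [Prod.fst_sum, hDW1]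
        · simp only [hW] at h2
          simp only [h2] at h1
          rcases μ with i | β
          · refine Eq.trans ?_ (congrArg (fun r => r.2.2.1 i) h1)
            simp only [Prod.snd_sum, Prod.fst_sum, Finset.sum_apply]
            rfl
          · refine Eq.trans ?_ (congrArg (fun r => r.2.2.2 β) h1)
            simp only [Prod.snd_sum, Finset.sum_apply]
            rfl
      have h6 : ((1, u) : Base (Fin m ⊕ Fin n)) = (1, 0) + (0, u) := by simp
      rw [← h5]
      simp only [h6, map_add, smul_add, Finset.sum_add_distrib]
      simp)
  obtain ⟨hL, hB⟩ := hquad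
  have hL' : ∀ j, fderiv ℝ (W j) (toBase q) (1, 0) = 0 := fun j => by
    simpa [Pi.single_apply, sum_apply] using hL (Pi.single (Sum.inl j) 1)
  have hpol : ∀ u v : Fin m ⊕ Fin n → ℝ,
      ∑ j, u (Sum.inl j) • fderiv ℝ (W j) (toBase q) (0, v) +
        ∑ j, v (Sum.inl j) • fderiv ℝ (W j) (toBase q) (0, u) = 0 := by
    intro u v
    have h1 := hB (u + v)
    have h2 := hB u
    have h3 := hB v
    simp only [map_add, LinearMap.add_apply, h2, h3, zero_add, add_zero] at h1
    rw [add_comm]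
    simpa [sum_apply] using h1
  have hsymm : ∀ j k, fderiv ℝ (W j) (toBase q) (baseDir m n k) =
      fderiv ℝ (W k) (toBase q) (baseDir m n j) := by
    intro j k
    simp only [hW]
    rw [S.fderiv_fderiv_baseDir M j hT, S.fderiv_fderiv_baseDir M k hT]
    exact (S.contDiffAt_field M hT).isSymmSndFDerivAt_of_infty.eq _ _
  -- In the directions $s^i$ the polarized form gives antisymmetry in $i,j$, against the symmetry of
  -- mixed partials. In the directions $s^\beta$ the second sum of `hpol` vanishes.
  have hdir : ∀ μ, fderiv ℝ (W j) (toBase q) (0, Pi.single μ 1) = 0 := by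
    intro μ
    have h := hpol (Pi.single (Sum.inl j) 1) (Pi.single μ 1)
    rcases μ with i | β
    · have h' : fderiv ℝ (W j) (toBase q) (baseDir m n i) +
          fderiv ℝ (W i) (toBase q) (baseDir m n j) = 0 := by
        simpa [Pi.single_apply, baseDir] using h
      rw [hsymm i j, ← two_smul ℝ] at h'
      exact (smul_eq_zero.1 h').resolve_left two_ne_zero
    · simpa [Pi.single_apply] using h
  refine ContinuousLinearMap.ext fun v => ?_
  change fderiv ℝ (W j) (toBase q) v = 0
  have hv : v = v.1 • (1, 0) + ∑ μ, v.2 μ • (0, Pi.single μ 1) := by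
    refine Prod.ext ?_ ?_
    · simp [Prod.fst_sum]
    · ext ν
      rcases ν with i | β <;> simp [Prod.snd_sum, Finset.sum_apply, Pi.single_apply]
  rw [hv, map_add, map_smul, map_sum, hL']
  simp only [map_smul, hdir, smul_zero, Finset.sum_const_zero, add_zero]

/-- The derivatives of `Y` along the `∂_{s^j}` are constant combinations of the `∂_{s^i}`. -/
def HasConstantDerivs (T : Set (Base (Fin m ⊕ Fin n)))
    (Y : Base (Fin m ⊕ Fin n) → Base (Fin m ⊕ Fin n)) : Prop :=
  ∀ j, ∃ b, toReducedBaseL m n b = 0 ∧ ∀ p ∈ T, fderiv ℝ Y p (baseDir m n j) = b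

/-- On a ball $[\partial_{s^j},X_M]$ is a constant combination of the $\partial_{s^i}$. Comparing it
with the structure equation, linear independence over ℝ on that ball kills the other constants. -/
theorem structureConst_eq_zero_of_isReducedSymmetry (S : IsStraightened U w X C)
    {M : Fin m ⊕ Fin k} (hI : IsReducedSymmetry w U (X M)) (j : Fin m) (L : Fin k) :
    C (Sum.inl j) M (Sum.inr L) = 0 := by
  obtain ⟨q, hq⟩ := S.nonempty
  have hT := mem_image_of_mem toBase hq
  obtain ⟨ε, hε, hball⟩ := Metric.isOpen_iff.1 S.isOpen_base _ hT
  set b := fderiv ℝ (X M) (toBase q) (baseDir m n j) with hb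
  have hconst : ∀ p ∈ Metric.ball (toBase q) ε, fderiv ℝ (X M) p (baseDir m n j) = b :=
    fun p hp => (convex_ball (toBase q) ε).is_const_of_fderivWithin_eq_zero (𝕜 := ℝ)
      (f := fun p => fderiv ℝ (X M) p (baseDir m n j))
      (fun x hx => ((S.contDiffAt_fderiv_baseDir M j (hball hx)).differentiableAt
        (by simp)).differentiableWithinAt)
      (fun x hx => by
        rw [fderivWithin_of_isOpen Metric.isOpen_ball hx]
        exact S.fderiv_fderiv_baseDir_eq_zero hI j (hball hx)) hp (Metric.mem_ball_self hε)
  have hbs := eq_sum_baseDir (S.toReducedBaseL_fderiv_baseDir hI j hT)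
  rw [← hb] at hbs
  have := S.indep (Metric.ball (toBase q) ε) Metric.isOpen_ball (Metric.nonempty_ball.2 hε) hball
    (fun N => C (Sum.inl j) M N - Sum.elim (fun i => b.2 (Sum.inl i)) 0 N) (fun p hp => by
      have h1 := hconst p hp
      rw [S.fderiv_field_baseDir M j (hball hp), hbs] at h1
      simp only [sub_smul, Finset.sum_sub_distrib]
      rw [h1, Fintype.sum_sum_type]
      simp [S.straight _ p (hball hp)]) (Sum.inr L)
  simpa using this

/-- Through the structure constants the derivative is the same vector on all components of the
domain, which local constancy alone would not give. -/
theorem hasConstantDerivs_of_structureConst (S : IsStraightened U w X C) {M : Fin m ⊕ Fin k}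
    (h : ∀ j L, C (Sum.inl j) M (Sum.inr L) = 0) : HasConstantDerivs (toBase '' U) (X M) := by
  intro j
  refine ⟨∑ i, C (Sum.inl j) M (Sum.inl i) • baseDir m n i, ?_, fun p hp => ?_⟩
  · simp [map_sum, toReducedBaseL_baseDir]
  · rw [S.fderiv_field_baseDir M j hp, Fintype.sum_sum_type]
    simp [h, S.straight _ p hp]

theorem prolong_fderiv_of_hasConstantDerivs (S : IsStraightened U w X C)
    {Y : Base (Fin m ⊕ Fin n) → Base (Fin m ⊕ Fin n)} (hR : HasConstantDerivs (toBase '' U) Y)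
    (j : Fin m) {q : Jet (Fin m ⊕ Fin n)} (hq : q ∈ U) :
    toReducedL m n (prolong (fun p => fderiv ℝ Y p (baseDir m n j)) q) = 0 := by
  obtain ⟨b, hb, hbY⟩ := hR j
  have h : (fun p => fderiv ℝ Y p (baseDir m n j)) =ᶠ[𝓝 (toBase q)] fun _ => b := by
    filter_upwards [S.isOpen_base.mem_nhds (mem_image_of_mem _ hq)] with p hp using hbY p hp
  rw [h.prolong_eq, prolong_const]
  have h1 : b.1 = 0 := congrArg Prod.fst hb
  exact Prod.ext h1 (Prod.ext (Prod.ext_iff.1 hb).2 rfl)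

/-- Each summand of `isReducedSymmetry_iff` vanishes: the $\partial_t$ component is zero and the
prolongation of a constant combination of the $\partial_{s^i}$ is annihilated by `dropSL`. Stated
for arbitrary $Y$ because it is also needed for brackets. -/
theorem isReducedSymmetry_of_hasConstantDerivs (S : IsStraightened U w X C)
    {Y : Base (Fin m ⊕ Fin n) → Base (Fin m ⊕ Fin n)} (hY : ContDiffOn ℝ ∞ Y (toBase '' U))
    (hsymm : IsPointSymmetry w U Y) (hR : HasConstantDerivs (toBase '' U) Y) :
    IsReducedSymmetry w U Y := by
  rw [S.isReducedSymmetry_iff hY hsymm]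
  refine fun q hq => Finset.sum_eq_zero fun j _ => ?_
  obtain ⟨b, hb, hbY⟩ := hR j
  have h1 : (fderiv ℝ Y (toBase q) (baseDir m n j)).1 = 0 := by
    rw [hbY _ (mem_image_of_mem _ hq)]
    exact congrArg Prod.fst hb
  have h2 := eq_sum_jetDir (S.prolong_fderiv_of_hasConstantDerivs hR j hq)
  rw [h1, zero_smul, sub_zero, h2, map_sum]
  simp [dropSL_jetDir]

theorem isReducedSymmetry_iff_structureConst (S : IsStraightened U w X C) (M : Fin m ⊕ Fin k) :
    IsReducedSymmetry w U (X M) ↔ ∀ j L, C (Sum.inl j) M (Sum.inr L) = 0 :=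
  ⟨fun h => S.structureConst_eq_zero_of_isReducedSymmetry h, fun h =>
    S.isReducedSymmetry_of_hasConstantDerivs (S.contDiffOn_field M) (S.symm M)
      (S.hasConstantDerivs_of_structureConst h)⟩

theorem hasConstantDerivs_of_isReducedSymmetry (S : IsStraightened U w X C) {M : Fin m ⊕ Fin k}
    (h : IsReducedSymmetry w U (X M)) : HasConstantDerivs (toBase '' U) (X M) :=
  S.hasConstantDerivs_of_structureConst ((S.isReducedSymmetry_iff_structureConst M).1 h)

theorem isPointSymmetry_sum_smul (S : IsStraightened U w X C) (c : Fin m ⊕ Fin k → ℝ) :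
    IsPointSymmetry w U (fun p => ∑ M, c M • X M p) := by
  intro q hq
  have hp := mem_image_of_mem toBase hq
  have hd : ∀ M, DifferentiableAt ℝ (X M) (toBase q) := fun M =>
    (S.contDiffAt_field M hp).differentiableAt (by simp)
  have hpr : prolong (fun p => ∑ M, c M • X M p) =ᶠ[𝓝 q]
      fun q => ∑ M, c M • prolong (X M) q := by
    filter_upwards [S.isOpen.mem_nhds hq] with q' hq'
    exact prolong_sum_smul c fun M =>
      (S.contDiffAt_field M (mem_image_of_mem _ hq')).differentiableAt (by simp)
  refine lieBracket_odeOperator_of_smul ((S.contDiffAt_rhs hq).differentiableAt (by simp))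
    (ContDiffAt.sum fun M _ => (S.contDiffAt_field M hp).const_smul (c M))
    (c := ∑ M, c M * -(fderiv ℝ (fun q : Jet (Fin m ⊕ Fin n) => (X M (toBase q)).1) q
      (odeOperator w q))) ?_
  rw [hpr.lieBracket_vectorField_eq (EventuallyEq.refl _ _), lieBracket_sum_smul_left c fun M =>
    (S.contDiffAt_field M hp).prolong.differentiableAt (by simp), Finset.sum_smul]
  refine Finset.sum_congr rfl fun M _ => ?_
  rw [S.symm M q hq, smul_smul]

/-- The bracket of two inherited generators is inherited. -/
theorem isReducedSymmetry_bracket (S : IsStraightened U w X C) {M N : Fin m ⊕ Fin k}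
    (hM : IsReducedSymmetry w U (X M)) (hN : IsReducedSymmetry w U (X N)) :
    IsReducedSymmetry w U (fun p => ∑ L, C M N L • X L p) := by
  refine S.isReducedSymmetry_of_hasConstantDerivs
    (ContDiffOn.sum fun L _ => (S.contDiffOn_field L).const_smul (C M N L))
    (S.isPointSymmetry_sum_smul _) fun j => ?_
  choose a ha haM using S.hasConstantDerivs_of_isReducedSymmetry hM
  choose b hb hbN using S.hasConstantDerivs_of_isReducedSymmetry hN
  refine ⟨∑ i, (a j).2 (Sum.inl i) • b i - ∑ i, (b j).2 (Sum.inl i) • a i, ?_, fun p hp => ?_⟩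
  · simp [map_sub, map_sum, ha, hb]
  have hbr : (fun p => ∑ L, C M N L • X L p) =ᶠ[𝓝 p] lieBracket ℝ (X M) (X N) := by
    filter_upwards [S.isOpen_base.mem_nhds hp] with p' hp' using (S.bracket M N p' hp').symm
  have hdir : ∀ (L : Fin m ⊕ Fin k) (c : Base (Fin m ⊕ Fin n)),
      (∀ p ∈ toBase '' U, fderiv ℝ (X L) p (baseDir m n j) = c) →
      lieBracket ℝ (X (Sum.inl j)) (X L) =ᶠ[𝓝 p] fun _ => c := by
    intro L c hc
    filter_upwards [S.isOpen_base.mem_nhds hp] with p' hp'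
    rw [S.lieBracket_straight j _ hp', hc p' hp']
  -- Jacobi: $[\partial_{s^j},[X_M,X_N]]=[a_j,X_N]+[X_M,b_j]$ with $a_j,b_j$ constant along the
  -- $\partial_{s^i}$, hence again a constant combination of these.
  have hleib := leibniz_identity_lieBracket (𝕜 := ℝ) (n := (2 : ℕ)) (by simp)
    (contDiffAt_infty.1 (S.contDiffAt_field (Sum.inl j) hp) 2)
    (contDiffAt_infty.1 (S.contDiffAt_field M hp) 2)
    (contDiffAt_infty.1 (S.contDiffAt_field N hp) 2)
  rw [S.lieBracket_straight j _ hp,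
    (hdir M (a j) (haM j)).lieBracket_vectorField_eq (EventuallyEq.refl _ _),
    (EventuallyEq.refl _ _).lieBracket_vectorField_eq (hdir N (b j) (hbN j))] at hleib
  rw [hbr.fderiv_eq, hleib, lieBracket_apply, lieBracket_apply]
  conv_lhs => rw [eq_sum_baseDir (ha j), eq_sum_baseDir (hb j)]
  simp [map_sum, haM _ p hp, hbN _ p hp, sub_eq_add_neg]

end IsStraightened

end Straightened

/-! ### Descent to the reduced variables. -/

section Reduction

variable {m n k : ℕ}

theorem toReducedL_surjective : Function.Surjective (toReducedL m n) := fun r =>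
  ⟨(r.1, Sum.elim 0 r.2.1, Sum.elim r.2.2.1 r.2.2.2), rfl⟩

theorem toReducedBaseL_surjective : Function.Surjective (toReducedBaseL m n) := fun b =>
  ⟨(b.1, Sum.elim 0 b.2), rfl⟩

theorem ContinuousLinearMap.exists_rightInverse_of_finiteDimensional {E R : Type*}
    [NormedAddCommGroup E] [NormedSpace ℝ E] [NormedAddCommGroup R] [NormedSpace ℝ R]
    [FiniteDimensional ℝ R] (π : E →L[ℝ] R) (hπ : Function.Surjective π) :
    ∃ σ : R →L[ℝ] E, ∀ r, π (σ r) = r := by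
  obtain ⟨σ, hσ⟩ := π.toLinearMap.exists_rightInverse_of_surjective (LinearMap.range_eq_top.2 hπ)
  exact ⟨LinearMap.toContinuousLinearMap σ, fun r => DFunLike.congr_fun hσ r⟩

theorem isOpen_toReduced_image {V : Set (Jet (Fin m ⊕ Fin n))} (hV : IsOpen V) :
    IsOpen (toReduced '' V) :=
  (toReducedL m n).isOpenMap toReducedL_surjective _ hV

theorem isOpen_toReducedBase_image {T : Set (Base (Fin m ⊕ Fin n))} (hT : IsOpen T) :
    IsOpen (toReducedBase '' T) :=
  (toReducedBaseL m n).isOpenMap toReducedBaseL_surjective _ hT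

theorem exists_factor_toReduced {F : Type*} [NormedAddCommGroup F] [NormedSpace ℝ F]
    {V : Set (Jet (Fin m ⊕ Fin n))} (hV : IsOpen V)
    (hconn : ∀ r, IsPreconnected (V ∩ toReduced ⁻¹' {r})) {f : Jet (Fin m ⊕ Fin n) → F}
    (hf : ContDiffOn ℝ ∞ f V) (hdir : ∀ q ∈ V, ∀ i, fderiv ℝ f q (jetDir m n i) = 0) :
    ∃ g : Reduced m n → F, ContDiffOn ℝ ∞ g (toReduced '' V) ∧ ∀ q ∈ V, f q = g (toReduced q) := by
  obtain ⟨σ, hσ⟩ :=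
    (toReducedL m n).exists_rightInverse_of_finiteDimensional toReducedL_surjective
  refine hf.exists_factor (toReducedL m n) σ hσ hV hconn fun q hq v hv => ?_
  rw [eq_sum_jetDir hv, map_sum]
  simp [hdir q hq]

theorem exists_factor_toReducedBase {F : Type*} [NormedAddCommGroup F] [NormedSpace ℝ F]
    {T : Set (Base (Fin m ⊕ Fin n))} (hT : IsOpen T)
    (hconn : ∀ b, IsPreconnected (T ∩ toReducedBase ⁻¹' {b})) {f : Base (Fin m ⊕ Fin n) → F}
    (hf : ContDiffOn ℝ ∞ f T) (hdir : ∀ p ∈ T, ∀ i, fderiv ℝ f p (baseDir m n i) = 0) :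
    ∃ g : Base (Fin n) → F, ContDiffOn ℝ ∞ g (toReducedBase '' T) ∧
      ∀ p ∈ T, f p = g (toReducedBase p) := by
  obtain ⟨σ, hσ⟩ :=
    (toReducedBaseL m n).exists_rightInverse_of_finiteDimensional toReducedBaseL_surjective
  refine hf.exists_factor (toReducedBaseL m n) σ hσ hT hconn fun q hq v hv => ?_
  rw [eq_sum_baseDir hv, map_sum]
  simp [hdir q hq]

theorem ContDiffAt.reducedOperator {wr : Reduced m n → Fin m ⊕ Fin n → ℝ} {r : Reduced m n}
    (hw : ContDiffAt ℝ ∞ wr r) : ContDiffAt ℝ ∞ (reducedOperator wr) r := by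
  rw [contDiffAt_pi] at hw
  exact contDiffAt_const.prodMk (contDiff_snd.snd.snd.contDiffAt.prodMk
    ((contDiffAt_pi.2 fun i => hw _).prodMk (contDiffAt_pi.2 fun β => hw _)))

theorem ContDiffAt.reducedField {ξ : Base (Fin n) → ℝ} {η : Base (Fin n) → Fin n → ℝ}
    {ζ : Reduced m n → Fin m ⊕ Fin n → ℝ} {r : Reduced m n} (hξ : ContDiffAt ℝ ∞ ξ (r.1, r.2.1))
    (hη : ContDiffAt ℝ ∞ η (r.1, r.2.1)) (hζ : ContDiffAt ℝ ∞ ζ r) :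
    ContDiffAt ℝ ∞ (reducedField ξ η ζ) r := by
  rw [contDiffAt_pi] at hζ
  have hb : ContDiffAt ℝ ∞ (fun r : Reduced m n => (r.1, r.2.1)) r :=
    contDiffAt_fst.prodMk contDiff_snd.fst.contDiffAt
  exact (ContDiffAt.comp r hξ hb).prodMk ((ContDiffAt.comp r hη hb).prodMk
    ((contDiffAt_pi.2 fun i => hζ _).prodMk (contDiffAt_pi.2 fun β => hζ _)))

namespace IsStraightened

variable {U : Set (Jet (Fin m ⊕ Fin n))} {w : Jet (Fin m ⊕ Fin n) → Fin m ⊕ Fin n → ℝ}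
  {X : Fin m ⊕ Fin k → Base (Fin m ⊕ Fin n) → Base (Fin m ⊕ Fin n)}
  {C : Fin m ⊕ Fin k → Fin m ⊕ Fin k → Fin m ⊕ Fin k → ℝ}
  {V : Set (Jet (Fin m ⊕ Fin n))}

theorem exists_reducedOperator (S : IsStraightened U w X C) (hV : IsOpen V) (hVU : V ⊆ U)
    (hconn : ConnectedSlices V) : ∃ wr : Reduced m n → Fin m ⊕ Fin n → ℝ,
      ContDiffOn ℝ ∞ wr (toReduced '' V) ∧
      ∀ q ∈ V, toReduced (odeOperator w q) = reducedOperator wr (toReduced q) := by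
  obtain ⟨wr, hwr, h⟩ := exists_factor_toReduced hV hconn.1 (S.contDiffOn_rhs.mono hVU)
    fun q hq i => S.fderiv_rhs_jetDir i (hVU hq)
  refine ⟨wr, hwr, fun q hq => ?_⟩
  rw [reducedOperator, ← h q hq]
  rfl

/-- Two factorizations are made: ξ and η descend from the base, using the slices of its projection,
so that they depend on $(t,s^\alpha)$ only; the velocity components descend from the jets. The
derivatives along $s^i$ vanish because they come from a constant combination of the
$\partial_{s^j}$. -/
theorem exists_reducedField (S : IsStraightened U w X C) (hV : IsOpen V) (hVU : V ⊆ U)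
    (hconn : ConnectedSlices V) {Y : Base (Fin m ⊕ Fin n) → Base (Fin m ⊕ Fin n)}
    (hY : ContDiffOn ℝ ∞ Y (toBase '' U)) (hR : HasConstantDerivs (toBase '' U) Y) :
    ∃ (ξ : Base (Fin n) → ℝ) (η : Base (Fin n) → Fin n → ℝ)
      (ζ : Reduced m n → Fin m ⊕ Fin n → ℝ),
      ContDiffOn ℝ ∞ ξ (toReducedBase '' (toBase '' V)) ∧
      ContDiffOn ℝ ∞ η (toReducedBase '' (toBase '' V)) ∧
      ContDiffOn ℝ ∞ ζ (toReduced '' V) ∧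
      ∀ q ∈ V, toReduced (prolong Y q) = reducedField ξ η ζ (toReduced q) := by
  have hTU : toBase '' V ⊆ toBase '' U := image_mono hVU
  have hYp : ∀ p ∈ toBase '' U, ContDiffAt ℝ ∞ Y p := fun p hp =>
    hY.contDiffAt (S.isOpen_base.mem_nhds hp)
  have hprol : ∀ q ∈ U, ContDiffAt ℝ ∞ (prolong Y) q := fun q hq =>
    (hYp _ (mem_image_of_mem _ hq)).prolong
  obtain ⟨g, hg, hgY⟩ := exists_factor_toReducedBase (isOpenMap_toBase _ hV) hconn.2
    (f := fun p => toReducedBaseL m n (Y p))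
    ((toReducedBaseL m n).contDiff.comp_contDiffOn (hY.mono hTU)) (fun p hp i => by
      obtain ⟨b, hb, hbY⟩ := hR i
      have h := (toReducedBaseL m n).hasFDerivAt.comp p
        ((hYp p (hTU hp)).differentiableAt (by simp)).hasFDerivAt
      have h' : fderiv ℝ (fun p => toReducedBaseL m n (Y p)) p = _ := h.fderiv
      rw [h', ContinuousLinearMap.comp_apply, hbY p (hTU hp), hb])
  obtain ⟨ζ, hζ, hζY⟩ := exists_factor_toReduced hV hconn.1
    (f := fun q => velocityL _ (prolong Y q))
    ((velocityL (Fin m ⊕ Fin n)).contDiff.comp_contDiffOn (f := prolong Y) fun q hq =>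
      (hprol q (hVU hq)).contDiffWithinAt)
    (fun q hq i => by
      have h := (velocityL (Fin m ⊕ Fin n)).hasFDerivAt.comp q
        ((hprol q (hVU hq)).differentiableAt (by simp)).hasFDerivAt
      have h' : fderiv ℝ (fun q => velocityL _ (prolong Y q)) q = _ := h.fderiv
      rw [h', ContinuousLinearMap.comp_apply, S.fderiv_prolong_jetDir i (hVU hq)
        (hYp _ (mem_image_of_mem _ (hVU hq)))]
      have h0 := S.prolong_fderiv_of_hasConstantDerivs hR i (hVU hq)
      funext μ
      rcases μ with j | β
      · exact congrFun (congrArg (fun r => r.2.2.1) h0) j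
      · exact congrFun (congrArg (fun r => r.2.2.2) h0) β)
  refine ⟨fun b => (g b).1, fun b => (g b).2, ζ, hg.fst, hg.snd, hζ, fun q hq => ?_⟩
  have h1 := hgY _ (mem_image_of_mem toBase hq)
  have h2 := hζY q hq
  change toReduced _ = ((g (toReducedBase (toBase q))).1, (g (toReducedBase (toBase q))).2, _, _)
  rw [← h1, ← h2]
  rfl

/-- The reduction of a straightened system and of its symmetries on a set with connected slices. -/
theorem exists_reduction (S : IsStraightened U w X C) {I : Finset (Fin k)}
    (hI : ∀ l, l ∈ I ↔ IsReducedSymmetry w U (X (Sum.inr l))) (hV : IsOpen V) (hVU : V ⊆ U)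
    (hconn : ConnectedSlices V) :
    ∃ (wr : Reduced m n → Fin m ⊕ Fin n → ℝ) (ξ : Fin k → Base (Fin n) → ℝ)
      (η : Fin k → Base (Fin n) → Fin n → ℝ) (ζ : Fin k → Reduced m n → Fin m ⊕ Fin n → ℝ),
      (ContDiffOn ℝ ∞ wr (toReduced '' V) ∧
        ∀ q ∈ V, toReduced (odeOperator w q) = reducedOperator wr (toReduced q)) ∧
      (∀ l ∈ I, ContDiffOn ℝ ∞ (ξ l) (toReducedBase '' (toBase '' V)) ∧
        ContDiffOn ℝ ∞ (η l) (toReducedBase '' (toBase '' V)) ∧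
        ContDiffOn ℝ ∞ (ζ l) (toReduced '' V) ∧
        ∀ q ∈ V, toReduced (prolong (X (Sum.inr l)) q) =
          reducedField (ξ l) (η l) (ζ l) (toReduced q)) ∧
      (∀ l ∈ I, ∀ r ∈ toReduced '' V,
        lieBracket ℝ (reducedField (ξ l) (η l) (ζ l)) (reducedOperator wr) r =
          -(fderiv ℝ (fun r : Reduced m n => ξ l (r.1, r.2.1)) r (reducedOperator wr r)) •
            reducedOperator wr r) ∧
      (∀ l ∈ I, ∀ l' ∈ I, ∀ q ∈ V,
        lieBracket ℝ (reducedField (ξ l) (η l) (ζ l))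
            (reducedField (ξ l') (η l') (ζ l')) (toReduced q) =
          ∑ l'', C (Sum.inr l) (Sum.inr l') (Sum.inr l'') •
            toReduced (prolong (X (Sum.inr l'')) q)) ∧
      ((∀ c : Fin m ⊕ Fin k → ℝ, IsReducedSymmetry w U (fun p => ∑ M, c M • X M p) →
          ∀ l, l ∉ I → c (Sum.inr l) = 0) →
        (∀ l ∈ I, ∀ l' ∈ I, ∀ l'', l'' ∉ I → C (Sum.inr l) (Sum.inr l') (Sum.inr l'') = 0) ∧
        ∀ l ∈ I, ∀ l' ∈ I, ∀ r ∈ toReduced '' V,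
          lieBracket ℝ (reducedField (ξ l) (η l) (ζ l)) (reducedField (ξ l') (η l') (ζ l')) r =
            ∑ l'' ∈ I, C (Sum.inr l) (Sum.inr l') (Sum.inr l'') •
              reducedField (ξ l'') (η l'') (ζ l'') r) := by
  obtain ⟨wr, hwr, hA⟩ := S.exists_reducedOperator hV hVU hconn
  have hex : ∀ l, ∃ (ξ : Base (Fin n) → ℝ) (η : Base (Fin n) → Fin n → ℝ)
      (ζ : Reduced m n → Fin m ⊕ Fin n → ℝ), l ∈ I →
      ContDiffOn ℝ ∞ ξ (toReducedBase '' (toBase '' V)) ∧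
      ContDiffOn ℝ ∞ η (toReducedBase '' (toBase '' V)) ∧
      ContDiffOn ℝ ∞ ζ (toReduced '' V) ∧
      ∀ q ∈ V, toReduced (prolong (X (Sum.inr l)) q) =
        reducedField ξ η ζ (toReduced q) := by
    intro l
    by_cases hl : l ∈ I
    · obtain ⟨ξ, η, ζ, h⟩ := S.exists_reducedField hV hVU hconn (S.contDiffOn_field (Sum.inr l))
        (S.hasConstantDerivs_of_isReducedSymmetry ((hI l).1 hl))
      exact ⟨ξ, η, ζ, fun _ => h⟩
    · exact ⟨0, 0, 0, fun h => absurd h hl⟩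
  choose ξ η ζ hF using hex
  have hfield : ∀ l ∈ I, ∀ q ∈ V,
      DifferentiableAt ℝ (reducedField (ξ l) (η l) (ζ l)) (toReduced q) := by
    intro l hl q hq
    obtain ⟨h1, h2, h3, -⟩ := hF l hl
    have hb := (isOpen_toReducedBase_image (isOpenMap_toBase _ hV)).mem_nhds
      (mem_image_of_mem toReducedBase (mem_image_of_mem toBase hq))
    exact ((h1.contDiffAt hb).reducedField (h2.contDiffAt hb) (h3.contDiffAt
      ((isOpen_toReduced_image hV).mem_nhds (mem_image_of_mem _ hq)))).differentiableAt (by simp)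
  have hprol : ∀ M, ∀ q ∈ V, DifferentiableAt ℝ (prolong (X M)) q := fun M q hq =>
    (S.contDiffAt_field M (mem_image_of_mem _ (hVU hq))).prolong.differentiableAt (by simp)
  have hrel : ∀ l ∈ I, ∀ q ∈ V, ∀ᶠ y in 𝓝 q, reducedField (ξ l) (η l) (ζ l) (toReducedL m n y) =
      toReducedL m n (prolong (X (Sum.inr l)) y) := by
    intro l hl q hq
    filter_upwards [hV.mem_nhds hq] with y hy using ((hF l hl).2.2.2 y hy).symm
  have hbr : ∀ l ∈ I, ∀ l' ∈ I, ∀ q ∈ V,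
      lieBracket ℝ (reducedField (ξ l) (η l) (ζ l))
          (reducedField (ξ l') (η l') (ζ l')) (toReduced q) =
        ∑ l'', C (Sum.inr l) (Sum.inr l') (Sum.inr l'') •
          toReduced (prolong (X (Sum.inr l'')) q) := by
    intro l hl l' hl' q hq
    have hp := mem_image_of_mem toBase (hVU hq)
    -- The bracket is computed upstairs, where prolongation is a homomorphism, and projected; the
    -- terms with $\partial_{s^i}$ project to zero.
    have h := (toReducedL m n).lieBracket_of_related (hprol (Sum.inr l) q hq)
      (hprol (Sum.inr l') q hq) (hfield l hl q hq) (hfield l' hl' q hq) (hrel l hl q hq)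
      (hrel l' hl' q hq)
    rw [toReducedL_apply] at h
    have hpr : lieBracket ℝ (X (Sum.inr l)) (X (Sum.inr l')) =ᶠ[𝓝 (toBase q)]
        fun p => ∑ M, C (Sum.inr l) (Sum.inr l') M • X M p := by
      filter_upwards [S.isOpen_base.mem_nhds hp] with p hp using S.bracket _ _ p hp
    rw [h, lieBracket_prolong (S.contDiffAt_field _ hp) (S.contDiffAt_field _ hp), hpr.prolong_eq,
      prolong_sum_smul _ fun M => (S.contDiffAt_field M hp).differentiableAt (by simp), map_sum,
      Fintype.sum_sum_type]
    simp only [map_smul, S.prolong_straight _ (hVU hq), toReducedL_jetDir, smul_zero,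
      Finset.sum_const_zero, zero_add]
    rfl
  refine ⟨wr, ξ, η, ζ, ⟨hwr, hA⟩, hF, ?_, hbr, fun hspan => ?_⟩
  · rintro l hl _ ⟨q, hq, rfl⟩
    have hwq := ((hwr.contDiffAt ((isOpen_toReduced_image hV).mem_nhds
      (mem_image_of_mem _ hq))).reducedOperator).differentiableAt (by simp)
    have h := (toReducedL m n).lieBracket_of_related (hprol (Sum.inr l) q hq)
      ((S.contDiffAt_rhs (hVU hq)).odeOperator.differentiableAt (by simp)) (hfield l hl q hq) hwq
      (hrel l hl q hq) (by
        filter_upwards [hV.mem_nhds hq] with y hy using (hA y hy).symm)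
    rw [toReducedL_apply, S.symm _ q (hVU hq), map_smul, toReducedL_apply, hA q hq] at h
    rw [h]
    congr 2
    -- The factor $\mathbf A(\xi)$ equals the reduced operator applied to the reduced ξ, by the
    -- chain rule.
    have hξ : DifferentiableAt ℝ (fun r : Reduced m n => ξ l (r.1, r.2.1)) (toReduced q) :=
      (hfield l hl q hq).fst
    have hcomp := hξ.hasFDerivAt.comp q (toReducedL m n).hasFDerivAt
    have heq : (fun q : Jet (Fin m ⊕ Fin n) => (X (Sum.inr l) (toBase q)).1) =ᶠ[𝓝 q]
        (fun r : Reduced m n => ξ l (r.1, r.2.1)) ∘ toReducedL m n := by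
      filter_upwards [hrel l hl q hq] with y hy using (congrArg Prod.fst hy).symm
    rw [heq.fderiv_eq]
    refine (DFunLike.congr_fun hcomp.fderiv _).trans ?_
    rw [ContinuousLinearMap.comp_apply, toReducedL_apply, hA q hq]
  · have hC : ∀ l ∈ I, ∀ l' ∈ I, ∀ l'', l'' ∉ I →
        -- The spanning hypothesis is applied to the bracket itself, whose coefficients are the
        -- structure constants.
        C (Sum.inr l) (Sum.inr l') (Sum.inr l'') = 0 := fun l hl l' hl' =>
      hspan _ (S.isReducedSymmetry_bracket ((hI l).1 hl) ((hI l').1 hl'))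
    refine ⟨hC, ?_⟩
    rintro l hl l' hl' _ ⟨q, hq, rfl⟩
    rw [hbr l hl l' hl' q hq, ← Finset.sum_subset (Finset.subset_univ I)
      fun l'' _ hl'' => by rw [hC l hl l' hl' l'' hl'', zero_smul]]
    exact Finset.sum_congr rfl fun l'' hl'' => by rw [(hF l'' hl'').2.2.2 q hq]

end IsStraightened

/-- In coordinates in normal form the system and its symmetries are straightened. -/
theorem isStraightened_of_isNormalForm {ι : Type} [Fintype ι] {U : Set (Jet ι)} (hU : IsOpen U)
    {w : Jet ι → ι → ℝ} (hw : ContDiffOn ℝ ∞ w U) {Z : Fin m ⊕ Fin k → Base ι → Base ι}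
    (hZ : ∀ M, ContDiffOn ℝ ∞ (Z M) (toBase '' U)) (hsymm : ∀ M, IsPointSymmetry w U (Z M))
    (hlin : ∀ W, IsOpen W → W.Nonempty → W ⊆ toBase '' U →
      LinearIndependent ℝ (fun M => W.domRestrict (Z M)))
    {C : Fin m ⊕ Fin k → Fin m ⊕ Fin k → Fin m ⊕ Fin k → ℝ}
    (hC : ∀ M N, ∀ p ∈ toBase '' U, lieBracket ℝ (Z M) (Z N) p = ∑ L, C M N L • Z L p)
    (hA : n = 0 → ∀ W, IsOpen W → W.Nonempty → W ⊆ U → ∃ q ∈ W,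
      odeOperator w q ∉ Submodule.span ℝ (range fun M => prolong (Z M) q))
    {Φ : OpenPartialHomeomorph (Base ι) (Base (Fin m ⊕ Fin n))}
    (hΦ : IsNormalForm (toBase '' U) (fun i => Z (Sum.inl i)) Φ) :
    IsStraightened (transformDomain Φ U) (transformRHS Φ w) (fun M => transformField Φ (Z M)) C := by
  have hΦ1 := hΦ.contDiffOn
  have hΦ2 := hΦ.contDiffOn_symm
  have hZs : ∀ M, ContDiffOn ℝ ∞ (Z M) Φ.source := fun M => (hZ M).mono hΦ.source_subset
  have hbase : toBase '' transformDomain Φ U = Φ.target := by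
    ext p
    constructor
    · rintro ⟨q, hq, rfl⟩
      exact hq.1
    · intro hp
      obtain ⟨q, hq, hqp⟩ := exists_toBase_eq_of_mem_target hΦ1 hΦ2 hU hΦ.source_subset hp
      exact ⟨q, hq, hqp⟩
  refine ⟨isOpen_transformDomain hΦ2 hU, ?_, contDiffOn_transformRHS hΦ1 hΦ2 hU hw, ?_, ?_, ?_,
    ?_, ?_, ?_⟩
  · rw [← image_nonempty (f := toBase), hbase]
    obtain ⟨p, hp⟩ := hΦ.source_nonempty
    exact ⟨_, Φ.map_source hp⟩
  · intro M
    rw [hbase]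
    exact contDiffOn_transformField hΦ1 hΦ2 (hZs M)
  · intro i p hp
    rw [hbase] at hp
    exact hΦ.normal_form i p hp
  · exact fun M => isPointSymmetry_transform hΦ1 hΦ2 hU hw (hZs M) (hsymm M)
  · intro M N p hp
    rw [hbase] at hp
    rw [lieBracket_transformField hΦ1 hΦ2 (hZs M) (hZs N) hp,
      hC M N _ (hΦ.source_subset (Φ.map_target hp)), map_sum]
    simp [transformField]
  · intro W hW hWne hWT c hc
    rw [hbase] at hWT
    refine Fintype.linearIndependent_iff.1 (hlin (Φ.source ∩ Φ ⁻¹' W)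
      (Φ.isOpen_inter_preimage hW) ?_ (inter_subset_left.trans hΦ.source_subset)) c ?_
    · obtain ⟨p, hp⟩ := hWne
      exact ⟨Φ.symm p, Φ.map_target (hWT hp), by rwa [mem_preimage, Φ.right_inv (hWT hp)]⟩
    · funext ⟨p, hp, hpW⟩
      have h := hc _ hpW
      simp only [transformField_apply_map hp, ← map_smul, ← map_sum] at h
      have h' := fderiv_symm_fderiv hΦ1 hΦ2 hp (∑ M, c M • Z M p)
      rw [h, map_zero] at h'
      simp [Finset.sum_apply, ← h']
  · intro hn W hW hWne hWU
    obtain ⟨x, ⟨hx1, hx2, hxW⟩, hx⟩ := hA hn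
      {q | toBase q ∈ Φ.source ∧ (totalDeriv Φ q).1 ≠ 0 ∧ jetLift Φ q ∈ W}
      (isOpen_jetDomain hΦ1 hW) (by
        obtain ⟨q, hq⟩ := hWne
        obtain ⟨x, -, hx1, hx2, hx3, -⟩ := exists_jetLift_eq hΦ1 hΦ2 (hWU hq)
        exact ⟨x, hx1, hx2, hx3.symm ▸ hq⟩) (by
        rintro x ⟨hx1, hx2, hxW⟩
        have := (hWU hxW).2.2
        rwa [(jetLift_symm_jetLift hΦ1 hΦ2 hx1 hx2).2.2] at this)
    refine ⟨_, hxW, fun hmem => hx ?_⟩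
    -- The derivative of the lifted map is injective and carries operator and prolonged generators
    -- to the new ones up to a nonzero factor, so membership in the span pulls back.
    rw [odeOperator_jetLift hΦ1 hΦ2 w hx1 hx2,
      Submodule.smul_mem_iff _ (inv_ne_zero hx2)] at hmem
    have hrange : (range fun M => prolong (transformField Φ (Z M)) (jetLift Φ x)) =
        (fderiv ℝ (jetLift Φ) x).toLinearMap '' range fun M => prolong (Z M) x := by
      rw [← range_comp]
      exact congrArg range (funext fun M => prolong_transformField hΦ1 hΦ2 (hZs M) hx1 hx2)
    rw [hrange, ← Submodule.map_span] at hmem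
    obtain ⟨y, hy, hyx⟩ := hmem
    rwa [fderiv_jetLift_injective hΦ1 hΦ2 hx1 hx2 hyx] at hy

end Reduction

/-! ### The theorem, assembled from straightening and reduction. -/

theorem theorem1 (m n k : ℕ)
    -- the system of `N = m + n` equations `ÿ = w(x, y, ẏ)` on the open set `U` of jets
    (U : Set (Jet (Fin (m + n)))) (hU : IsOpen U)
    (w : Jet (Fin (m + n)) → Fin (m + n) → ℝ) (hw : ContDiffOn ℝ ∞ w U)
    -- `D` is the set of points `(x, y)` that underlie the jets in `U`
    (D : Set (Base (Fin (m + n)))) (hD : D = toBase '' U)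
    -- the `r = m + k` generators: `Z (inl i)` span the Abelian subalgebra, `Z (inr l)` are the rest
    (Z : Fin m ⊕ Fin k → Base (Fin (m + n)) → Base (Fin (m + n)))
    (hZ : ∀ M, ContDiffOn ℝ ∞ (Z M) D)
    (hsymm : ∀ M, IsPointSymmetry w U (Z M))
    (hlin : ∀ W, IsOpen W → W.Nonempty → W ⊆ D →
      LinearIndependent ℝ (fun M => W.domRestrict (Z M)))
    (C : Fin m ⊕ Fin k → Fin m ⊕ Fin k → Fin m ⊕ Fin k → ℝ)
    (hC : ∀ M N, ∀ p ∈ D,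
      VectorField.lieBracket ℝ (Z M) (Z N) p = ∑ L, C M N L • Z L p)
    -- `A` is linearly independent of the generators (needed only if there are no variables `s^α`)
    (hA : n = 0 → ∀ W, IsOpen W → W.Nonempty → W ⊆ U → ∃ q ∈ W,
      odeOperator w q ∉
        Submodule.span ℝ (Set.range fun M => prolong (Z M) q))
    -- the subalgebra is Abelian and acts transitively in a subspace of dimension `m`
    (habel : ∀ i j, ∀ p ∈ D,
      VectorField.lieBracket ℝ (Z (Sum.inl i)) (Z (Sum.inl j)) p = 0)
    (htrans : ∀ p ∈ D, LinearIndependent ℝ (fun i => Z (Sum.inl i) p)) :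
    -- the generators `Z_i` can be put in normal form around every point
    (∀ p ∈ D, ∃ Φ : OpenPartialHomeomorph (Base (Fin (m + n)))
        (Base (Fin m ⊕ Fin n)),
      p ∈ Φ.source ∧ IsNormalForm D (fun i => Z (Sum.inl i)) Φ) ∧
    -- and whenever they are put in normal form:
    ∀ Φ : OpenPartialHomeomorph (Base (Fin (m + n)))
        (Base (Fin m ⊕ Fin n)),
      IsNormalForm D (fun i => Z (Sum.inl i)) Φ →
      ∀ I : Finset (Fin k),
      I = inheritedIndices Φ w U (fun l => Z (Sum.inr l)) →
      -- (1)
      (∀ l, l ∈ I ↔ ∀ i, ∀ p ∈ D,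
        VectorField.lieBracket ℝ (Z (Sum.inl i)) (Z (Sum.inr l)) p =
          ∑ j, C (Sum.inl i) (Sum.inr l) (Sum.inl j) • Z (Sum.inl j) p) ∧
      ∀ V, IsOpen V → V ⊆ transformDomain Φ U → ConnectedSlices V →
        ∃ (wr : Reduced m n → Fin m ⊕ Fin n → ℝ)
          (ξ : Fin k → Base (Fin n) → ℝ)
          (η : Fin k → Base (Fin n) → Fin n → ℝ)
          (ζ : Fin k → Reduced m n → Fin m ⊕ Fin n → ℝ),
          -- (2)
          (ContDiffOn ℝ ∞ wr (toReduced '' V) ∧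
            ∀ q ∈ V,
              toReduced
                  (odeOperator (transformRHS Φ w) q) =
                reducedOperator wr (toReduced q)) ∧
          -- (3)
          (∀ l ∈ I,
            ContDiffOn ℝ ∞ (ξ l) (toReducedBase '' (toBase '' V)) ∧
            ContDiffOn ℝ ∞ (η l) (toReducedBase '' (toBase '' V)) ∧
            ContDiffOn ℝ ∞ (ζ l) (toReduced '' V) ∧
            ∀ q ∈ V,
              toReduced
                  (prolong (transformField Φ (Z (Sum.inr l))) q) =
                reducedField (ξ l) (η l) (ζ l) (toReduced q)) ∧
          -- the reduced generators are symmetries of the reduced system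
          (∀ l ∈ I, ∀ r ∈ toReduced '' V,
            VectorField.lieBracket ℝ (reducedField (ξ l) (η l) (ζ l))
                (reducedOperator wr) r =
              -(fderiv ℝ (fun r : Reduced m n => ξ l (r.1, r.2.1)) r
                  (reducedOperator wr r)) •
                reducedOperator wr r) ∧
          -- (4), for an arbitrary choice of the remaining generators
          (∀ l ∈ I, ∀ l' ∈ I, ∀ q ∈ V,
            VectorField.lieBracket ℝ (reducedField (ξ l) (η l) (ζ l))
                (reducedField (ξ l') (η l') (ζ l')) (toReduced q) =
              ∑ l'', C (Sum.inr l) (Sum.inr l') (Sum.inr l'') •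
                toReduced
                  (prolong (transformField Φ (Z (Sum.inr l''))) q)) ∧
          -- (4), if every inherited element of the Lie algebra is a combination of the `Z_i` and
          -- of the inherited generators
          ((∀ c : Fin m ⊕ Fin k → ℝ,
              IsInherited Φ w U (fun p => ∑ M, c M • Z M p) →
                ∀ l, l ∉ I → c (Sum.inr l) = 0) →
            (∀ l ∈ I, ∀ l' ∈ I, ∀ l'', l'' ∉ I → C (Sum.inr l) (Sum.inr l') (Sum.inr l'') = 0) ∧
            ∀ l ∈ I, ∀ l' ∈ I, ∀ r ∈ toReduced '' V,
              VectorField.lieBracket ℝ (reducedField (ξ l) (η l) (ζ l))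
                  (reducedField (ξ l') (η l') (ζ l')) r =
                ∑ l'' ∈ I, C (Sum.inr l) (Sum.inr l') (Sum.inr l'') •
                  reducedField (ξ l'') (η l'') (ζ l'') r) := by
  have hDo : IsOpen D := hD ▸ isOpenMap_toBase _ hU
  refine ⟨fun p hp => exists_isNormalForm (by simp) hDo (fun i => hZ _) habel hp (htrans p hp),
    fun Φ hΦ I hI => ?_⟩
  subst hD
  have S := isStraightened_of_isNormalForm hU hw hZ hsymm hlin hC hA hΦ
  have hIS : ∀ l, l ∈ I ↔ IsReducedSymmetry (transformRHS Φ w) (transformDomain Φ U)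
      (transformField Φ (Z (Sum.inr l))) := by
    intro l
    simp only [hI, inheritedIndices, Finset.mem_filter, Finset.mem_univ, true_and]
    rfl
  refine ⟨fun l => ?_, fun V hV hVU hconn => ?_⟩
  · rw [hIS, S.isReducedSymmetry_iff_structureConst]
    constructor
    · intro h i p hp
      rw [hC _ _ p hp, Fintype.sum_sum_type]
      simp [h]
    · intro h i L
      have hne : (toBase '' U).Nonempty := hΦ.source_nonempty.mono hΦ.source_subset
      -- Subtracting the assumed bracket from the structure equation leaves a relation over ℝ among
      -- the remaining generators on all of $D$.
      have hind := Fintype.linearIndependent_iff.1 (hlin _ hDo hne Subset.rfl)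
        (Sum.elim 0 fun L => C (Sum.inl i) (Sum.inr l) (Sum.inr L)) (by
          funext ⟨p, hp⟩
          have h1 := h i p hp
          rw [hC _ _ p hp, Fintype.sum_sum_type, add_eq_left] at h1
          simpa [Finset.sum_apply] using h1) (Sum.inr L)
      exact hind
  · obtain ⟨wr, ξ, η, ζ, h1, h2, h3, h4, h5⟩ := S.exists_reduction hIS hV hVU hconn
    refine ⟨wr, ξ, η, ζ, h1, h2, h3, h4, fun hspan => h5 fun c hc => hspan c ?_⟩
    rw [IsInherited, transformField_sum_smul]
    exact hc
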